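/- Let $q\in[2,\infty]$ and let $n\ge 1$ be an integer. Let $X=(X_1,\dots,X_n)$ be a random vector uniformly distributed on $B_q^n=\{x\in\mathbb{R}^n:\ |x_1|^q+\dots+|x_n|^q\le 1\}$, where $B_\infty^n=[-1,1]^n$. For a real random variable $S$ and $r>0$ write $\|S\|_r=(\mathbb{E}|S|^r)^{1/r}$. For $p\ge 1$ put $$\gamma_p=\sqrt2\left(\frac{\Gamma(\frac{p+1}{2})}{\sqrt\pi}\right)^{1/p},\qquad \beta_{p,q,n}=\left(\frac{\Gamma(n/q+1)}{\Gamma((n+p)/q+1)}\right)^{1/p},$$ with the convention $\beta_{p,\infty,n}=1$, and $$A_{p,q,n}=\begin{cases}\dfrac{\beta_{p,q,n}}{\beta_{2,q,n}}\gamma_p,& p\in[1,2)\\[2mm] \dfrac{\|X_1\|_p}{\|X_1\|_2},& p\in[2,\infty)\end{cases}\qquad B_{p,q,n}=\begin{cases}\dfrac{\|X_1\|_p}{\|X_1\|_2},& p\in[1,2)\\[2mm] \dfrac{\beta_{p,q,n}}{\beta_{2,q,n}}\gamma_p,& p\in[2,\infty).\end{cases}$$ Then for every $p\ge1$ and all real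 numbers $a_1,\dots,a_n$, $$A_{p,q,n}\Big\|\sum_{i=1}^n a_iX_i\Big\|_2\le\Big\|\sum_{i=1}^n a_iX_i\Big\|_p\le B_{p,q,n}\Big\|\sum_{i=1}^n a_iX_i\Big\|_2 .$$ Moreover, for $p\in[2,\infty)$ the value $A_{p,q,n}$ is the largest constant for which the left-hand inequality holds for all real $a_1,\dots,a_n$, and for $p\in[1,2)$ the value $B_{p,q,n}$ is the smallest constant for which the right-hand inequality holds for all real $a_1,\dots,a_n$. -/

import Mathlib

open MeasureTheory
open scoped ENNReal

noncomputable section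

/-- The unit ball `B_q^n` of `ℓ_q^n`: the points with `|x_1|^q + ... + |x_n|^q ≤ 1`, and the cube
`[-1,1]^n` when `q = ∞`. -/
def lqBall (q : ℝ≥0∞) (n : ℕ) : Set (Fin n → ℝ) :=
  {x | if q = ∞ then ∀ i, |x i| ≤ 1 else ∑ i, |x i| ^ q.toReal ≤ 1}

/-- The `r`-th moment `‖S‖_r = (𝔼 |S|^r)^{1/r}` of a real random variable `S`. -/
def momentNorm {Ω : Type*} [MeasurableSpace Ω] (P : Measure Ω) (S : Ω → ℝ) (r : ℝ) : ℝ :=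
  (∫ ω, |S ω| ^ r ∂P) ^ (1 / r)

/-- The `p`-th moment `γ_p = √2 (Γ((p+1)/2) / √π)^{1/p}` of a standard Gaussian. -/
def gaussMoment (p : ℝ) : ℝ :=
  √2 * (Real.Gamma ((p + 1) / 2) / √Real.pi) ^ (1 / p)

/-- `β_{p,q,n} = (Γ(n/q + 1) / Γ((n+p)/q + 1))^{1/p}`; at `q = ∞` both quotients by `q` vanish and
the value is `1`. -/
def betaConst (p : ℝ) (q : ℝ≥0∞) (n : ℕ) : ℝ :=
  if q = ∞ then 1
  else (Real.Gamma (n / q.toReal + 1) / Real.Gamma ((n + p) / q.toReal + 1)) ^ (1 / p)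

/-- The lower constant `A_{p,q,n}`; `X₁` is the first coordinate of the random vector. -/
def khintchineA {Ω : Type*} [MeasurableSpace Ω] (P : Measure Ω) (X₁ : Ω → ℝ)
    (p : ℝ) (q : ℝ≥0∞) (n : ℕ) : ℝ :=
  if p < 2 then betaConst p q n / betaConst 2 q n * gaussMoment p
  else momentNorm P X₁ p / momentNorm P X₁ 2

/-- The upper constant `B_{p,q,n}`; `X₁` is the first coordinate of the random vector. -/
def khintchineB {Ω : Type*} [MeasurableSpace Ω] (P : Measure Ω) (X₁ : Ω → ℝ)
    (p : ℝ) (q : ℝ≥0∞) (n : ℕ) : ℝ :=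
  if p < 2 then momentNorm P X₁ p / momentNorm P X₁ 2
  else betaConst p q n / betaConst 2 q n * gaussMoment p

end

/-! Let `Y` have independent coordinates with density proportional to `exp (-|x|^q)`, or uniform on
`[-1, 1]` if `q = ∞`. Integrating a function homogeneous of degree `p` against `exp (-∑ |xᵢ|^q)`
layer by layer gives `Γ((n+p)/q+1)` times its integral over the ball. Hence `‖∑ aᵢXᵢ‖_p = β_{p,q,n}
‖∑ aᵢYᵢ‖_p`, with no factor in the cube case (`lintegral_cond_ball`, `cond_cube_eq_pi`). It remains
to place `‖∑ aᵢYᵢ‖_p` between `|a| ‖Y₁‖_p` and the `p`-norm of the centered Gaussian of the same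
variance, for `p ≥ 2`, and in the reverse order for `p ≤ 2`.

Both bounds come from changing one or two summands at a time. The sum `S` of the others is symmetric
unimodal by Wintner's theorem, hence a mixture of uniform laws on symmetric intervals, so that `𝔼|√t
+ S|^p` is convex in `t` for `p ≥ 2` and concave for `p ≤ 2` (`IsSymmUnimodal.convexOn`). The moment
is then the mean of a convex or concave function of the square of the summands being changed. The
sign `ε = ±1` lets one argument serve both cases.

For `q ≥ 2` the density of `Yᵢ` is log-concave in `x²`. Consequently a coordinate direction
minimizes `𝔼 ψ((cY₁ + sY₂)²)` over unit vectors `(c, s)`, for `ψ` convex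
(`IsSqLogConcaveDensity.integral_le_integral_prod`), and two terms merge into one. Moreover the
Gaussian density is log-affine in `x²`, so the density of `Yᵢ` exceeds it on a single interval of
values of `x²`; with equal variances this makes the Gaussian mean of `ψ` the larger one
(`IsSqLogConcaveDensity.integral_le_gaussianReal`). Induction over the summands gives the bounds,
and the first basis vector gives sharpness. -/

/-! ### Convexity in the square for averages over intervals. -/

open Set in
/-- The increments of a convex function over intervals of a fixed length are monotone. -/
theorem ConvexOn.increment_le {f : ℝ → ℝ} {s : Set ℝ} (hf : ConvexOn ℝ s f) {x z d : ℝ}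
    (hx : x ∈ s) (hz : z + d ∈ s) (hxz : x ≤ z) (hd : 0 ≤ d) :
    f (x + d) - f x ≤ f (z + d) - f z := by
  rcases hd.eq_or_lt with rfl | hd
  · simp
  rcases hxz.eq_or_lt with rfl | hxz
  · exact le_rfl
  have hL : 0 < z + d - x := by linarith
  have e : (z - x) / (z + d - x) + d / (z + d - x) = 1 := by field_simp; ring
  have n1 : 0 ≤ (z - x) / (z + d - x) := div_nonneg (by linarith) hL.le
  have n2 : 0 ≤ d / (z + d - x) := div_nonneg hd.le hL.le
  have h1 := hf.2 hx hz n1 n2 e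
  have h2 := hf.2 hx hz n2 n1 (by linarith)
  have e1 : ((z - x) / (z + d - x)) • x + (d / (z + d - x)) • (z + d) = x + d := by
    simp only [smul_eq_mul]; field_simp; ring
  have e2 : (d / (z + d - x)) • x + ((z - x) / (z + d - x)) • (z + d) = z := by
    simp only [smul_eq_mul]; field_simp; ring
  rw [e1] at h1
  rw [e2] at h2
  simp only [smul_eq_mul] at h1 h2
  have e3 : (z - x) / (z + d - x) = 1 - d / (z + d - x) := by linarith
  rw [e3] at h1 h2
  linarith

-- Since `|x|^(p-2) x` is the odd extension of `x^(p-1)`, monotonicity reduces on `[0, r]` and on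
-- `[r, ∞)` to comparing increments of the convex function `ε x^(p-1)`. Up to the factor `p` the
-- function is the derivative of `ε (|y+r|^p - |y-r|^p)`.
open Set in
theorem monotoneOn_signed_rpow_add {ε r p : ℝ} (hr : 0 < r) (hp : 1 < p)
    (hε : ConvexOn ℝ (Ici 0) fun x : ℝ => ε * x ^ (p - 1)) :
    MonotoneOn (fun y : ℝ => ε * (|y + r| ^ (p - 2) * (y + r) - |y - r| ^ (p - 2) * (y - r)))
      (Ici 0) := by
  have key : ∀ x : ℝ, 0 ≤ x → |x| ^ (p - 2) * x = x ^ (p - 1) := by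
    intro x hx
    rcases hx.eq_or_lt with rfl | hx
    · rw [Real.zero_rpow (by linarith)]; simp
    · rw [abs_of_pos hx, ← Real.rpow_add_one hx.ne']; ring_nf
  have h1 : MonotoneOn (fun y : ℝ => ε * (|y + r| ^ (p - 2) * (y + r) - |y - r| ^ (p - 2) * (y - r)))
      (Icc 0 r) := by
    intro y hy z hz hyz
    have e : ∀ y ∈ Icc 0 r, ε * (|y + r| ^ (p - 2) * (y + r) - |y - r| ^ (p - 2) * (y - r))
        = ε * (r + y) ^ (p - 1) + ε * (r - y) ^ (p - 1) := by
      intro y hy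
      have := key (r - y) (by linarith [hy.2])
      rw [key (y + r) (by linarith [hy.1]), ← neg_sub r y, abs_neg, mul_neg, this, add_comm y r]
      ring
    simp only [e y hy, e z hz]
    have := hε.increment_le (x := r - z) (z := r + y) (d := z - y) (by simp [hz.2])
      (by simp; linarith [hz.1]) (by linarith [hy.1, hz.1]) (by linarith)
    rw [show r - z + (z - y) = r - y by ring, show r + y + (z - y) = r + z by ring] at this
    linarith
  have h2 : MonotoneOn (fun y : ℝ => ε * (|y + r| ^ (p - 2) * (y + r) - |y - r| ^ (p - 2) * (y - r)))
      (Ici r) := by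
    intro y hy z hz hyz
    simp only [mem_Ici] at hy hz
    simp only
    rw [key (y + r) (by linarith), key (y - r) (by linarith), key (z + r) (by linarith),
      key (z - r) (by linarith)]
    have := hε.increment_le (x := y - r) (z := y + r) (d := z - y) (by simp [hy])
      (by simp; linarith) (by linarith) (by linarith)
    rw [show y - r + (z - y) = z - r by ring, show y + r + (z - y) = z + r by ring] at this
    linarith
  have := h1.union_right h2 (c := r) ⟨⟨hr.le, le_rfl⟩, fun x hx => hx.2⟩ ⟨le_refl r, fun x hx => hx⟩
  rwa [Icc_union_Ici_eq_Ici hr.le] at this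

open Set in
theorem convexOn_abs_add_rpow_sub {ε r p : ℝ} (hr : 0 < r) (hp : 1 < p)
    (hε : ConvexOn ℝ (Ici 0) fun x : ℝ => ε * x ^ (p - 1)) :
    ConvexOn ℝ (Ici 0) fun y : ℝ => ε * (|y + r| ^ p - |y - r| ^ p) := by
  have hd : ∀ y : ℝ, HasDerivAt (fun y : ℝ => ε * (|y + r| ^ p - |y - r| ^ p))
      (p * (ε * (|y + r| ^ (p - 2) * (y + r) - |y - r| ^ (p - 2) * (y - r)))) y := by
    intro y
    have h1 := (hasDerivAt_abs_rpow (y + r) hp).comp y ((hasDerivAt_id y).add_const r)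
    have h2 := (hasDerivAt_abs_rpow (y - r) hp).comp y ((hasDerivAt_id y).sub_const r)
    refine ((h1.sub h2).const_mul ε).congr_deriv ?_
    ring
  refine MonotoneOn.convexOn_of_deriv (convex_Ici 0)
    (fun y _ => (hd y).continuousAt.continuousWithinAt)
    (fun y _ => (hd y).differentiableAt.differentiableWithinAt) ?_
  have : deriv (fun y : ℝ => ε * (|y + r| ^ p - |y - r| ^ p)) =
      fun y => p * (ε * (|y + r| ^ (p - 2) * (y + r) - |y - r| ^ (p - 2) * (y - r))) :=
    funext fun y => (hd y).deriv
  rw [this]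
  intro y hy z hz hyz
  exact mul_le_mul_of_nonneg_left
    (monotoneOn_signed_rpow_add hr hp hε (interior_subset hy) (interior_subset hz) hyz) (by linarith)

-- With `W y = ε (|y+r|^p - |y-r|^p)`, the derivative in `t` is `W(√t) / (2√t)`. As `W 0 = 0`, this
-- is half the slope of a chord of `W` from the origin, which increases because `W` is convex.
open Set in
theorem convexOn_integral_abs_sqrt_add_rpow {ε r p : ℝ} (hp : 1 ≤ p)
    (hε : ConvexOn ℝ (Ici 0) fun y : ℝ => ε * (|y + r| ^ p - |y - r| ^ p)) :
    ConvexOn ℝ (Ici 0) fun t : ℝ => ε * ∫ s in (-r)..r, |√t + s| ^ p := by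
  have hc : Continuous fun u : ℝ => |u| ^ p :=
    continuous_abs.rpow_const fun _ => Or.inr (by linarith)
  set Φ : ℝ → ℝ := fun u => ∫ v in (0 : ℝ)..u, |v| ^ p with hΦ
  have hΦd : ∀ u, HasDerivAt Φ (|u| ^ p) u := fun u => (hc.integral_hasStrictDerivAt 0 u).hasDerivAt
  have hV : (fun t : ℝ => ε * ∫ s in (-r)..r, |√t + s| ^ p) =
      fun t => ε * (Φ (√t + r) - Φ (√t - r)) := by
    funext t
    rw [intervalIntegral.integral_comp_add_left (fun u : ℝ => |u| ^ p) (√t)]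
    rw [hΦ]
    simp only
    rw [intervalIntegral.integral_interval_sub_left (hc.intervalIntegrable _ _)
      (hc.intervalIntegrable _ _)]
    rfl
  rw [hV]
  have hΦc : Continuous Φ := continuous_iff_continuousAt.2 fun u => (hΦd u).continuousAt
  have hd : ∀ t ∈ Ioi (0 : ℝ), HasDerivAt (fun t => ε * (Φ (√t + r) - Φ (√t - r)))
      ((1 / 2) * ((ε * (|√t + r| ^ p - |√t - r| ^ p)) / √t)) t := by
    intro t ht
    have hs := Real.hasDerivAt_sqrt (ne_of_gt ht)
    have h1 := (hΦd (√t + r)).comp t (hs.add_const r)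
    have h2 := (hΦd (√t - r)).comp t (hs.sub_const r)
    refine ((h1.sub h2).const_mul ε).congr_deriv ?_
    have : √t ≠ 0 := (Real.sqrt_pos.2 ht).ne'
    field_simp
  refine MonotoneOn.convexOn_of_deriv (convex_Ici 0) (by fun_prop)
    (fun t ht => (hd t (by simpa using ht)).differentiableAt.differentiableWithinAt) ?_
  rw [interior_Ici]
  intro t ht u hu htu
  rw [(hd t ht).deriv, (hd u hu).deriv]
  have hst : 0 < √t := Real.sqrt_pos.2 ht
  have hsu : 0 < √u := Real.sqrt_pos.2 hu
  have := hε.secant_mono (a := 0) (x := √t) (y := √u) (by simp) hst.le hsu.le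
    hst.ne' hsu.ne' (Real.sqrt_le_sqrt htu)
  simp only [zero_add, zero_sub, abs_neg, sub_self, mul_zero, sub_zero] at this
  linarith

open Set in
/-- For `p ≥ 2` the uniform average of `|· + s|^p` over a symmetric interval is a convex function of
the square, and for `1 ≤ p ≤ 2` it is a concave one. -/
theorem convexOn_integral_interval {ε r p : ℝ} (hr : 0 < r) (hp : 1 ≤ p)
    (hε : (2 ≤ p ∧ ε = 1) ∨ (p ≤ 2 ∧ ε = -1)) :
    ConvexOn ℝ (Ici 0) fun t : ℝ => ε * ∫ s in (-r)..r, |√t + s| ^ p := by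
  apply convexOn_integral_abs_sqrt_add_rpow hp
  -- At `p = 1` the power is not differentiable, but the difference is simply `2 min(y, r)`, which
  -- is concave.
  rcases hp.eq_or_lt with rfl | hp
  · obtain ⟨h, -⟩ | ⟨-, rfl⟩ := hε
    · norm_num at h
    have : ConcaveOn ℝ (Ici 0) fun y : ℝ => 2 * (y ⊓ r) :=
      ((concaveOn_id (convex_Ici 0)).inf (concaveOn_const r (convex_Ici 0))).smul zero_le_two
    refine this.neg.congr fun y hy => ?_
    simp only [mem_Ici] at hy
    simp only [Pi.neg_apply, Real.rpow_one]
    rw [abs_of_nonneg (by linarith : 0 ≤ y + r)]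
    rcases le_total y r with h | h
    · rw [inf_eq_left.2 h, abs_of_nonpos (by linarith)]; ring
    · rw [inf_eq_right.2 h, abs_of_nonneg (by linarith)]; ring
  · apply convexOn_abs_add_rpow_sub hr hp
    obtain ⟨h, rfl⟩ | ⟨h, rfl⟩ := hε
    · simpa using convexOn_rpow (by linarith : 1 ≤ p - 1)
    · have := (Real.concaveOn_rpow (by linarith : 0 ≤ p - 1) (by linarith)).neg
      refine this.congr fun y hy => by simp

/-! ### Symmetric unimodal measures as mixtures of symmetric intervals. -/

/-- A density on the line that is even, nonincreasing on the half-line and bounded. -/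
structure IsUnimodalDensity (f : ℝ → ℝ≥0∞) : Prop where
  measurable : Measurable f
  ne_top : f 0 ≠ ∞
  anti : ∀ x y, |x| ≤ |y| → f y ≤ f x

/-- A symmetric unimodal measure: the Dirac mass at the origin, or a measure with a symmetric
unimodal density. -/
def IsSymmUnimodal (μ : Measure ℝ) : Prop :=
  μ = Measure.dirac 0 ∨ ∃ f, IsUnimodalDensity f ∧ μ = volume.withDensity f

theorem IsUnimodalDensity.lt_top {f : ℝ → ℝ≥0∞} (hf : IsUnimodalDensity f) (x : ℝ) : f x < ∞ :=
  (hf.anti 0 x (by simp)).trans_lt hf.ne_top.lt_top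

theorem IsUnimodalDensity.comp_neg {f : ℝ → ℝ≥0∞} (hf : IsUnimodalDensity f) (x : ℝ) :
    f (-x) = f x :=
  le_antisymm (hf.anti _ _ (by simp)) (hf.anti _ _ (by simp))

open Set in
/-- A symmetric star-shaped subset of the line of finite measure is a symmetric interval, up to a
null set. -/
theorem exists_ae_eq_Ioc_of_symmetric {A : Set ℝ} (hA : ∀ x ∈ A, ∀ y, |y| ≤ |x| → y ∈ A)
    (hfin : volume A < ∞) : ∃ r : ℝ, 0 ≤ r ∧ A =ᵐ[volume] Ioc (-r) r := by
  have hb : ∀ x ∈ A, |x| ≤ (volume A).toReal := by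
    intro x hx
    have h1 : Icc (-|x|) |x| ⊆ A := fun y hy => hA x hx y (abs_le.2 hy)
    have h2 := measure_mono (μ := volume) h1
    rw [Real.volume_Icc, ENNReal.ofReal_le_iff_le_toReal hfin.ne] at h2
    linarith [abs_nonneg x]
  rcases A.eq_empty_or_nonempty with rfl | ⟨x₀, hx₀⟩
  · exact ⟨0, le_rfl, by simp⟩
  have hbdd : BddAbove A := ⟨_, fun x hx => (le_abs_self x).trans (hb x hx)⟩
  have habs : ∀ x ∈ A, |x| ∈ A := fun x hx => hA x hx _ (by simp)
  refine ⟨sSup A, (abs_nonneg x₀).trans (le_csSup hbdd (habs x₀ hx₀)), ?_⟩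
  have hsub : A ⊆ Icc (-sSup A) (sSup A) := fun x hx => abs_le.1 (le_csSup hbdd (habs x hx))
  have hsup : Ioo (-sSup A) (sSup A) ⊆ A := by
    intro x hx
    obtain ⟨y, hy, hxy⟩ := exists_lt_of_lt_csSup ⟨x₀, hx₀⟩ (abs_lt.2 hx)
    exact hA y hy x (hxy.le.trans (le_abs_self y))
  have h1 : A ≤ᵐ[volume] Ioc (-sSup A) (sSup A) :=
    (LE.le.eventuallyLE hsub).trans Ioc_ae_eq_Icc.symm.le
  have h2 : Ioc (-sSup A) (sSup A) ≤ᵐ[volume] A :=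
    Ioo_ae_eq_Ioc.symm.le.trans (LE.le.eventuallyLE hsup)
  exact h1.antisymm h2

open Set in
/-- Layer-cake principle: a function with nonnegative integral over every symmetric interval has
nonnegative integral against every symmetric unimodal density. -/
theorem IsUnimodalDensity.integral_nonneg {f : ℝ → ℝ≥0∞} (hf : IsUnimodalDensity f)
    (hfi : ∫⁻ x, f x ≠ ∞) {D : ℝ → ℝ} (hDm : Measurable D)
    (hD : Integrable D (volume.withDensity f)) (hr : ∀ r, 0 ≤ r → 0 ≤ ∫ s in (-r)..r, D s) :
    0 ≤ ∫ s, D s ∂(volume.withDensity f) := by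
  have hlt : ∀ᵐ x ∂(volume : Measure ℝ), f x < ∞ := ae_of_all _ hf.lt_top
  rw [integrable_withDensity_iff_integrable_smul' hf.measurable hlt] at hD
  rw [integral_withDensity_eq_integral_toReal_smul hf.measurable hlt]
  set F : ℝ → ℝ := fun x => (f x).toReal with hF
  have hFm : Measurable F := hf.measurable.ennreal_toReal
  have hF0 : ∀ x, 0 ≤ F x := fun x => ENNReal.toReal_nonneg
  have hFi : Integrable F := integrable_toReal_of_lintegral_ne_top hf.measurable.aemeasurable hfi
  set ν : Measure ℝ := volume.restrict (Ioi 0) with hν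
  -- `S` is the region under the graph of the density. Its horizontal sections are the superlevel
  -- sets, symmetric intervals up to null sets, so Fubini for `D` cut off to `S` reduces the claim
  -- to `hr`.
  set S : Set (ℝ × ℝ) := {z | z.2 < F z.1} with hS
  have hSm : MeasurableSet S := measurableSet_lt measurable_snd (hFm.comp measurable_fst)
  set h : ℝ × ℝ → ℝ := S.indicator fun z => D z.1 with hh
  have hhm : Measurable h := (hDm.comp measurable_fst).indicator hSm
  have hsec : ∀ x, (fun τ => h (x, τ)) = (Iio (F x)).indicator fun _ => D x := by
    intro x; ext τ; simp [hh, hS, indicator_apply]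
  have hcut : ∀ x, Iio (F x) ∩ Ioi 0 = Ioo 0 (F x) := by
    intro x; ext τ; simp [and_comm]
  have hint : ∀ x (c : ℝ), ∫ τ, (Iio (F x)).indicator (fun _ => c) τ ∂ν = F x * c := by
    intro x c
    rw [integral_indicator measurableSet_Iio, Measure.restrict_restrict measurableSet_Iio, hcut]
    simp [Measure.real, hF0 x]
  have hprod : Integrable h ((volume : Measure ℝ).prod ν) := by
    rw [integrable_prod_iff hhm.aestronglyMeasurable]
    constructor
    · refine ae_of_all _ fun x => ?_
      rw [hsec x]
      refine IntegrableOn.integrable_indicator ?_ measurableSet_Iio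
      refine integrableOn_const ?_
      rw [Measure.restrict_apply measurableSet_Iio, hcut]
      simp
    · have : (fun x => ∫ τ, ‖h (x, τ)‖ ∂ν) = fun x => ‖F x • D x‖ := by
        ext x
        have : (fun τ => ‖h (x, τ)‖) = (Iio (F x)).indicator fun _ => ‖D x‖ := by
          ext τ
          rw [congrFun (hsec x) τ, norm_indicator_eq_indicator_norm]
        rw [this, hint, norm_smul, Real.norm_of_nonneg (hF0 x)]
      rw [this]
      exact hD.norm
  have e1 : ∫ x, F x • D x = ∫ x, ∫ τ, h (x, τ) ∂ν := by
    refine integral_congr_ae (ae_of_all _ fun x => ?_)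
    simp only
    rw [hsec x, hint, smul_eq_mul]
  rw [e1, integral_integral_swap (f := fun x τ => h (x, τ)) hprod]
  refine setIntegral_nonneg measurableSet_Ioi fun τ hτ => ?_
  have e2 : (fun x => h (x, τ)) = {x | τ < F x}.indicator D := by
    ext x; simp [hh, hS, indicator_apply]
  rw [e2, integral_indicator (measurableSet_lt measurable_const hFm)]
  obtain ⟨r, hr0, hr1⟩ := exists_ae_eq_Ioc_of_symmetric (A := {x | τ < F x})
    (fun x hx y hyx => lt_of_lt_of_le (show τ < F x from hx)
      (ENNReal.toReal_mono (hf.lt_top y).ne (hf.anti y x hyx))) (hFi.measure_gt_lt_top hτ)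
  rw [setIntegral_congr_set hr1, ← intervalIntegral.integral_of_le (by linarith)]
  exact hr r hr0

theorem IsSymmUnimodal.map_neg {μ : Measure ℝ} (hμ : IsSymmUnimodal μ) :
    μ.map (fun x => -x) = μ := by
  rcases hμ with rfl | ⟨f, hf, rfl⟩
  · rw [Measure.map_dirac' measurable_neg]; simp
  · ext s hs
    rw [Measure.map_apply measurable_neg hs, withDensity_apply _ hs,
      withDensity_apply _ (measurable_neg hs), ← lintegral_indicator hs,
      ← lintegral_indicator (measurable_neg hs), ← lintegral_neg_eq_self (s.indicator f)]
    refine lintegral_congr fun x => ?_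
    classical
    change (Neg.neg ⁻¹' s).indicator f x = s.indicator f (-x)
    simp only [Set.indicator_apply, hf.comp_neg, Set.mem_preimage]

theorem MeasureTheory.MemLp.integrable_abs_rpow {α : Type*} [MeasurableSpace α] {μ : Measure α}
    {g : α → ℝ} {p : ℝ} (hp : 0 < p) (hg : MemLp g (ENNReal.ofReal p) μ) :
    Integrable (fun x => |g x| ^ p) μ := by
  have := hg.integrable_norm_rpow (by simpa using hp) (by simp)
  simpa [ENNReal.toReal_ofReal hp.le] using this

theorem memLp_of_integrable_abs_rpow {α : Type*} [MeasurableSpace α] {μ : Measure α}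
    {g : α → ℝ} {p : ℝ} (hp : 0 < p) (hgm : AEStronglyMeasurable g μ)
    (hg : Integrable (fun x => |g x| ^ p) μ) : MemLp g (ENNReal.ofReal p) μ := by
  rw [← integrable_norm_rpow_iff hgm (by simpa using hp) (by simp)]
  simpa [ENNReal.toReal_ofReal hp.le] using hg

/-- The `p`-th absolute moment of a symmetric unimodal law shifted by `√t` is convex in `t` for
`p ≥ 2` and concave for `1 ≤ p ≤ 2`. -/
theorem IsSymmUnimodal.convexOn {μ : Measure ℝ} [IsProbabilityMeasure μ] (hμ : IsSymmUnimodal μ)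
    {ε p : ℝ} (hp : 1 ≤ p) (hε : (2 ≤ p ∧ ε = 1) ∨ (p ≤ 2 ∧ ε = -1))
    (hm : MemLp (fun s : ℝ => s) (ENNReal.ofReal p) μ) :
    ConvexOn ℝ (Set.Ici 0) fun t : ℝ => ε * ∫ s, |√t + s| ^ p ∂μ := by
  have hp0 : 0 < p := by linarith
  have hint : ∀ t : ℝ, Integrable (fun s => |√t + s| ^ p) μ := fun t =>
    ((memLp_const (√t)).add hm).integrable_abs_rpow hp0
  rcases hμ with rfl | ⟨f, hf, rfl⟩
  · have e : ∀ t ∈ Set.Ici (0 : ℝ), ε * t ^ (p / 2) =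
        ε * ∫ s, |√t + s| ^ p ∂(Measure.dirac (0 : ℝ)) := by
      intro t ht
      simp only [integral_dirac, add_zero]
      rw [abs_of_nonneg (Real.sqrt_nonneg t), Real.sqrt_eq_rpow, ← Real.rpow_mul ht]
      ring_nf
    refine ConvexOn.congr ?_ e
    obtain ⟨h, rfl⟩ | ⟨h, rfl⟩ := hε
    · simpa using convexOn_rpow (by linarith : 1 ≤ p / 2)
    · have := (Real.concaveOn_rpow (by linarith : 0 ≤ p / 2) (by linarith)).neg
      exact this.congr fun y hy => by simp
  · refine ⟨convex_Ici 0, fun t ht u hu a b ha hb hab => ?_⟩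
    have hfi : ∫⁻ x, f x ≠ ∞ := by
      have := measure_ne_top (volume.withDensity f) Set.univ
      rwa [withDensity_apply _ MeasurableSet.univ, Measure.restrict_univ] at this
    -- `D` is the convexity gap before integration in `s`. Its integral over each symmetric interval
    -- is nonnegative by the case of uniform laws.
    set D : ℝ → ℝ := fun s => a * (ε * |√t + s| ^ p) + b * (ε * |√u + s| ^ p)
      - ε * |√(a * t + b * u) + s| ^ p with hD
    have hDm : Measurable D := by fun_prop
    have key : 0 ≤ ∫ s, D s ∂(volume.withDensity f) := by
      refine hf.integral_nonneg hfi hDm ?_ fun r hr => ?_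
      · exact ((((hint t).const_mul ε).const_mul a).add (((hint u).const_mul ε).const_mul b)).sub
          ((hint _).const_mul ε)
      · rcases hr.eq_or_lt with rfl | hr
        · simp
        have := (convexOn_integral_interval hr hp hε).2 ht hu ha hb hab
        simp only [smul_eq_mul] at this
        have hi : ∀ t : ℝ, IntervalIntegrable (fun s => |√t + s| ^ p) volume (-r) r := fun t =>
          Continuous.intervalIntegrable (Continuous.rpow_const (by fun_prop)
            fun _ => Or.inr hp0.le) _ _
        rw [hD, intervalIntegral.integral_sub
          ((((hi t).const_mul ε).const_mul a).add (((hi u).const_mul ε).const_mul b))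
          ((hi _).const_mul ε),
          intervalIntegral.integral_add (((hi t).const_mul ε).const_mul a)
          (((hi u).const_mul ε).const_mul b)]
        simp only [intervalIntegral.integral_const_mul]
        linarith
    have h12 : Integrable (fun s => a * (ε * |√t + s| ^ p) + b * (ε * |√u + s| ^ p))
        (volume.withDensity f) :=
      (((hint t).const_mul ε).const_mul a).add (((hint u).const_mul ε).const_mul b)
    simp only [hD] at key
    rw [integral_sub h12 ((hint _).const_mul ε), integral_add (((hint t).const_mul ε).const_mul a)
      (((hint u).const_mul ε).const_mul b)] at key
    simp only [integral_const_mul] at key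
    simp only [smul_eq_mul]
    linarith

/-! ### Unimodality under convolution and scaling. -/

theorem ENNReal.mul_add_mul_le_of_le {a b c d : ℝ≥0∞} (hab : b ≤ a) (hcd : d ≤ c) :
    a * d + b * c ≤ a * c + b * d := by
  obtain ⟨e, rfl⟩ := exists_add_of_le hab
  calc (b + e) * d + b * c = b * c + b * d + e * d := by ring
    _ ≤ b * c + b * d + e * c := by gcongr
    _ = (b + e) * c + b * d := by ring

/-- Wintner's theorem: the convolution of two symmetric unimodal densities is symmetric unimodal. -/
theorem IsUnimodalDensity.lconvolution {f g : ℝ → ℝ≥0∞} (hf : IsUnimodalDensity f)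
    (hg : IsUnimodalDensity g) (hgi : ∫⁻ x, g x ≠ ∞) :
    IsUnimodalDensity (lconvolution f g volume) where
  measurable := measurable_lconvolution _ hf.measurable hg.measurable
  ne_top := by
    rw [lconvolution_def]
    have : ∫⁻ y, f y * g (-y + 0) ≤ ∫⁻ y, f 0 * g y := by
      refine lintegral_mono fun y => ?_
      simp only [add_zero, hg.comp_neg]
      exact mul_le_mul_left (hf.anti 0 y (by simp)) _
    refine (this.trans_lt ?_).ne
    rw [lintegral_const_mul _ hg.measurable]
    exact ENNReal.mul_lt_top hf.ne_top.lt_top hgi.lt_top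
  anti := by
    intro y z hyz
    have hfm := hf.measurable
    have hgm := hg.measurable
    have hsub : ∀ u v : ℝ, ∫⁻ x, f x * g (-x + u) = ∫⁻ x, f (u + v - x) * g (x - v) := by
      intro u v
      rw [← lintegral_sub_left_eq_self _ (u + v)]
      refine lintegral_congr fun x => ?_
      ring_nf
    -- Averaging with the reflection `x ↦ u + v - x` makes the values at `y` and `z` comparable
    -- pointwise: the integrands differ by `(f x - f (z+y-x)) (g (x-y) - g (x-z))`.
    have hadd : ∀ u v : ℝ, 2 * ∫⁻ x, f x * g (-x + u)
        = ∫⁻ x, (f x * g (x - u) + f (u + v - x) * g (x - v)) := by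
      intro u v
      rw [two_mul, lintegral_add_left (by fun_prop), ← hsub u v]
      congr 1
      refine lintegral_congr fun x => ?_
      rw [← hg.comp_neg]
      ring_nf
    rw [lconvolution_def, lconvolution_def,
      ← ENNReal.mul_le_mul_iff_right two_ne_zero ENNReal.ofNat_ne_top, hadd z y, hadd y z]
    refine lintegral_mono fun x => ?_
    have hyz2 : 0 ≤ (z + y) * (z - y) := by nlinarith [sq_le_sq.2 hyz]
    simp only
    rw [add_comm y z]
    -- The two differences of squares `(z+y-x)² - x²` and `(x-z)² - (x-y)²` have product `(z² -
    -- y²)(z+y-2x)² ≥ 0`. Opposite orderings therefore occur only if `z = ±y` or `2x = z + y`, where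
    -- both sides agree. The sign `c = ±1` covers the two mixed cases.
    have hcomm : ∀ c : ℝ, 0 ≤ c * ((z + y) * (z + y - 2 * x)) → c * ((z - y) * (z + y - 2 * x)) ≤ 0 →
        c ≠ 0 → f x * g (x - z) + f (z + y - x) * g (x - y) ≤
          f x * g (x - y) + f (z + y - x) * g (x - z) := by
      intro c h1 h2 hc
      have h3 : c ^ 2 * (((z + y) * (z - y)) * (z + y - 2 * x) ^ 2) ≤ 0 := by nlinarith
      have h4 : ((z + y) * (z - y)) * (z + y - 2 * x) ^ 2 = 0 :=
        le_antisymm (nonpos_of_mul_nonpos_right h3 (by positivity)) (by positivity)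
      rcases mul_eq_zero.1 h4 with h5 | h5
      · rcases mul_eq_zero.1 h5 with h6 | h6
        · have : z = -y := by linarith
          subst this
          have e : -y + y - x = -x := by ring
          rw [e, hf.comp_neg, add_comm]
        · have : z = y := by linarith
          simp [this]
      · have e1 : z + y - x = x := by linarith [pow_eq_zero_iff two_ne_zero |>.1 h5]
        rw [e1, add_comm]
    rcases le_total (|x - y|) (|x - z|) with h | h
    · rcases le_total (|x|) (|z + y - x|) with h' | h'
      · exact ENNReal.mul_add_mul_le_of_le (hf.anti _ _ h') (hg.anti _ _ h)
      · exact hcomm (-1) (by nlinarith [sq_le_sq.2 h']) (by nlinarith [sq_le_sq.2 h]) (by norm_num)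
    · rcases le_total (|z + y - x|) (|x|) with h' | h'
      · rw [add_comm, add_comm (f x * g (x - y))]
        exact ENNReal.mul_add_mul_le_of_le (hf.anti _ _ h') (hg.anti _ _ h)
      · exact hcomm 1 (by nlinarith [sq_le_sq.2 h']) (by nlinarith [sq_le_sq.2 h]) (by norm_num)

theorem IsSymmUnimodal.conv {μ ν : Measure ℝ} [IsProbabilityMeasure μ] [IsProbabilityMeasure ν]
    (hμ : IsSymmUnimodal μ) (hν : IsSymmUnimodal ν) : IsSymmUnimodal (μ.conv ν) := by
  rcases hμ with rfl | ⟨f, hf, rfl⟩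
  · rwa [Measure.dirac_zero_conv]
  rcases hν with rfl | ⟨g, hg, rfl⟩
  · rw [Measure.conv_dirac_zero]
    exact Or.inr ⟨f, hf, rfl⟩
  refine Or.inr ⟨_, hf.lconvolution hg ?_, conv_withDensity_eq_lconvolution hf.measurable hg.measurable⟩
  have := measure_ne_top (volume.withDensity g) Set.univ
  rwa [withDensity_apply _ MeasurableSet.univ, Measure.restrict_univ] at this

theorem IsSymmUnimodal.map_const_mul {μ : Measure ℝ} [IsProbabilityMeasure μ]
    (hμ : IsSymmUnimodal μ) (a : ℝ) : IsSymmUnimodal (μ.map (a * ·)) := by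
  rcases eq_or_ne a 0 with rfl | ha
  -- Zero coefficients produce the Dirac mass, which is why it is admitted among the unimodal laws.
  · left
    simp
  rcases hμ with rfl | ⟨f, hf, rfl⟩
  · left
    rw [Measure.map_dirac' (measurable_const_mul a), mul_zero]
  have hfm := hf.measurable
  refine Or.inr ⟨fun x => ENNReal.ofReal |a⁻¹| * f (a⁻¹ * x), ⟨by fun_prop, ?_, ?_⟩, ?_⟩
  · simp only [mul_zero]
    exact ENNReal.mul_ne_top ENNReal.ofReal_ne_top hf.ne_top
  · intro x y hxy
    refine mul_le_mul_right (hf.anti _ _ ?_) _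
    rw [abs_mul, abs_mul]
    gcongr
  · ext s hs
    have hs' : MeasurableSet ((a * ·) ⁻¹' s) := measurable_const_mul a hs
    rw [Measure.map_apply (measurable_const_mul a) hs, withDensity_apply _ hs,
      withDensity_apply _ hs', lintegral_const_mul _ (by fun_prop),
      ← lintegral_indicator hs, ← lintegral_indicator hs', ← smul_eq_mul, ← lintegral_smul_measure,
      ← Real.map_volume_mul_left ha, lintegral_map (by measurability) (measurable_const_mul a)]
    refine lintegral_congr fun x => ?_
    classical
    simp only [Set.indicator_apply, Set.mem_preimage, inv_mul_cancel_left₀ ha]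

/-! ### Densities log-concave in the square. -/

/-- A density on the line, even and nonincreasing on the half-line, which is log-concave as a
function of the square of its argument. -/
structure IsSqLogConcaveDensity (f : ℝ → ℝ) : Prop where
  measurable : Measurable f
  nonneg : ∀ x, 0 ≤ f x
  anti : ∀ x y, |x| ≤ |y| → f y ≤ f x
  logConcave : ∀ s t a b : ℝ, 0 ≤ s → 0 ≤ t → 0 < a → 0 < b → a + b = 1 →
    f √s ^ a * f √t ^ b ≤ f √(a * s + b * t)

theorem IsSqLogConcaveDensity.isSymmUnimodal {f : ℝ → ℝ} (hf : IsSqLogConcaveDensity f) :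
    IsSymmUnimodal (volume.withDensity fun x => ENNReal.ofReal (f x)) :=
  Or.inr ⟨_, ⟨hf.measurable.ennreal_ofReal, ENNReal.ofReal_ne_top,
    fun x y h => ENNReal.ofReal_le_ofReal (hf.anti x y h)⟩, rfl⟩

theorem IsSqLogConcaveDensity.apply_sqrt_sq {f : ℝ → ℝ} (hf : IsSqLogConcaveDensity f) (x : ℝ) :
    f √(x ^ 2) = f x := by
  rw [Real.sqrt_sq_eq_abs]
  exact le_antisymm (hf.anti _ _ (by simp)) (hf.anti _ _ (by simp))

theorem exists_convex_weights {s t s' t' : ℝ} (h : s + t = s' + t') (h1 : s' ≤ s) (h2 : s ≤ t') :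
    ∃ a b : ℝ, 0 ≤ a ∧ 0 ≤ b ∧ a + b = 1 ∧ s = a * s' + b * t' ∧ t = b * s' + a * t' := by
  rcases (h1.trans h2).eq_or_lt with h3 | h3
  · exact ⟨1, 0, by simp, le_rfl, by simp, by linarith, by linarith⟩
  have h4 : 0 < t' - s' := by linarith
  refine ⟨(t' - s) / (t' - s'), (s - s') / (t' - s'), div_nonneg (by linarith) h4.le,
    div_nonneg (by linarith) h4.le, by field_simp; ring, by field_simp; ring, ?_⟩
  have : t = s' + t' - s := by linarith
  rw [this]
  field_simp
  ring

/-- The inner pair is obtained from the outer one by convex weights `(a, b)` and `(b, a)`;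
multiplying the two log-concavity inequalities makes the exponents add up to `1`. -/
theorem IsSqLogConcaveDensity.mul_le_mul_sqrt {f : ℝ → ℝ} (hf : IsSqLogConcaveDensity f)
    {s t s' t' : ℝ} (hs' : 0 ≤ s') (ht' : 0 ≤ t') (h : s + t = s' + t') (h1 : s' ≤ s)
    (h2 : s ≤ t') : f √s' * f √t' ≤ f √s * f √t := by
  obtain ⟨a, b, ha, hb, hab, rfl, rfl⟩ := exists_convex_weights h h1 h2
  rcases ha.eq_or_lt with rfl | ha
  · obtain rfl : b = 1 := by linarith
    simp [mul_comm]
  rcases hb.eq_or_lt with rfl | hb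
  · obtain rfl : a = 1 := by linarith
    simp
  have e1 := hf.logConcave s' t' a b hs' ht' ha hb hab
  have e2 := hf.logConcave s' t' b a hs' ht' hb ha (by linarith)
  have n := hf.nonneg
  calc f √s' * f √t' = (f √s' ^ a * f √t' ^ b) * (f √s' ^ b * f √t' ^ a) := by
        rw [mul_mul_mul_comm, ← Real.rpow_add_of_nonneg (n _) ha.le hb.le,
          ← Real.rpow_add_of_nonneg (n _) hb.le ha.le, hab, add_comm b a, hab, Real.rpow_one,
          Real.rpow_one]
    _ ≤ _ := mul_le_mul e1 e2 (mul_nonneg (Real.rpow_nonneg (n _) _) (Real.rpow_nonneg (n _) _)) (n _)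

/-- On a circle, the point with the larger maximal squared coordinate has the more spread pair of
squares. Spreading lowers the product density here and raises a convex sum in
`ConvexOn.add_le_add_of_max_sq`; the planar comparison rests on this opposition. -/
theorem IsSqLogConcaveDensity.mul_le_mul_of_max_sq {f : ℝ → ℝ} (hf : IsSqLogConcaveDensity f)
    {x y u v : ℝ} (h : x ^ 2 + y ^ 2 = u ^ 2 + v ^ 2)
    (hm : max (x ^ 2) (y ^ 2) ≤ max (u ^ 2) (v ^ 2)) : f u * f v ≤ f x * f y := by
  rw [← hf.apply_sqrt_sq x, ← hf.apply_sqrt_sq y, ← hf.apply_sqrt_sq u, ← hf.apply_sqrt_sq v]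
  obtain ⟨hx, hy⟩ := max_le_iff.1 hm
  rcases le_total (u ^ 2) (v ^ 2) with huv | huv
  · rw [max_eq_right huv] at hx hy
    exact hf.mul_le_mul_sqrt (sq_nonneg _) (sq_nonneg _) h (by linarith) hx
  · rw [max_eq_left huv] at hx hy
    rw [mul_comm]
    exact hf.mul_le_mul_sqrt (sq_nonneg _) (sq_nonneg _) (by linarith) (by linarith) hx

theorem ConvexOn.add_le_add_of_max_sq {ψ : ℝ → ℝ} (hψ : ConvexOn ℝ (Set.Ici 0) ψ)
    {x y u v : ℝ} (h : x ^ 2 + y ^ 2 = u ^ 2 + v ^ 2)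
    (hm : max (x ^ 2) (y ^ 2) ≤ max (u ^ 2) (v ^ 2)) :
    ψ (x ^ 2) + ψ (y ^ 2) ≤ ψ (u ^ 2) + ψ (v ^ 2) := by
  have key : ∀ s t s' t' : ℝ, 0 ≤ s' → 0 ≤ t' → s + t = s' + t' → s' ≤ s → s ≤ t' →
      ψ s + ψ t ≤ ψ s' + ψ t' := by
    intro s t s' t' hs' ht' h h1 h2
    obtain ⟨a, b, ha, hb, hab, rfl, rfl⟩ := exists_convex_weights h h1 h2
    have e1 := hψ.2 (show s' ∈ Set.Ici 0 from hs') (show t' ∈ Set.Ici 0 from ht') ha hb hab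
    have e2 := hψ.2 (show s' ∈ Set.Ici 0 from hs') (show t' ∈ Set.Ici 0 from ht') hb ha
      (by linarith)
    simp only [smul_eq_mul] at e1 e2
    have hb' : b = 1 - a := by linarith
    subst hb'
    linarith
  obtain ⟨hx, hy⟩ := max_le_iff.1 hm
  rcases le_total (u ^ 2) (v ^ 2) with huv | huv
  · rw [max_eq_right huv] at hx hy
    exact key _ _ _ _ (sq_nonneg _) (sq_nonneg _) h (by linarith) hx
  · rw [max_eq_left huv] at hx hy
    rw [add_comm (ψ (u ^ 2))]
    exact key _ _ _ _ (sq_nonneg _) (sq_nonneg _) (by linarith) (by linarith) hx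

/-! ### Comparison of directions in the plane. -/

/-- The reflection of the plane that maps the first basis vector to `(c, s)`. -/
noncomputable def planeReflection (c s : ℝ) : ℝ × ℝ →ₗ[ℝ] ℝ × ℝ :=
  Matrix.toLin (Module.Basis.finTwoProd ℝ) (Module.Basis.finTwoProd ℝ) !![c, s; s, -c]

theorem planeReflection_apply (c s : ℝ) (z : ℝ × ℝ) :
    planeReflection c s z = (c * z.1 + s * z.2, s * z.1 - c * z.2) := by
  simp [planeReflection, Matrix.toLin_finTwoProd_apply, sub_eq_add_neg]

theorem measurePreserving_planeReflection {c s : ℝ} (h : c ^ 2 + s ^ 2 = 1) :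
    MeasurePreserving (planeReflection c s) (volume : Measure (ℝ × ℝ)) volume := by
  have hdet : LinearMap.det (planeReflection c s) = -1 := by
    rw [planeReflection, LinearMap.det_toLin, Matrix.det_fin_two_of]
    linarith
  refine ⟨(LinearMap.continuous_of_finiteDimensional _).measurable, ?_⟩
  rw [Measure.map_linearMap_addHaar_eq_smul_addHaar _ (by rw [hdet]; norm_num), hdet]
  norm_num

/-- Being its own inverse is the advantage of a reflection over a rotation: it makes `K ∘ R - K`
change sign under `R`. -/
theorem planeReflection_involutive {c s : ℝ} (h : c ^ 2 + s ^ 2 = 1) (z : ℝ × ℝ) :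
    planeReflection c s (planeReflection c s z) = z := by
  simp only [planeReflection_apply]
  ext
  · simp only
    linear_combination z.1 * h
  · simp only
    linear_combination z.2 * h

/-- Among the unit directions in the plane, a coordinate direction minimizes the integral of a
convex function of the square, for a product of two square-log-concave densities. -/
theorem IsSqLogConcaveDensity.integral_le_integral_prod {f : ℝ → ℝ}
    (hf : IsSqLogConcaveDensity f) {ν : Measure ℝ}
    (hν : ν = volume.withDensity fun x => ENNReal.ofReal (f x)) [IsProbabilityMeasure ν]
    {ψ : ℝ → ℝ} (hψ : ConvexOn ℝ (Set.Ici 0) ψ)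
    (hint : ∀ c s : ℝ, Integrable (fun z : ℝ × ℝ => ψ ((c * z.1 + s * z.2) ^ 2)) (ν.prod ν))
    {c s : ℝ} (h : c ^ 2 + s ^ 2 = 1) :
    ∫ x, ψ (x ^ 2) ∂ν ≤ ∫ z : ℝ × ℝ, ψ ((c * z.1 + s * z.2) ^ 2) ∂(ν.prod ν) := by
  have hfm := hf.measurable
  set R := planeReflection c s with hR
  have hRapp := planeReflection_apply c s
  have hRmp := measurePreserving_planeReflection h
  have hRinv := planeReflection_involutive h
  rw [← hR] at hRapp hRmp hRinv
  have hRe : MeasurableEmbedding R :=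
    MeasurableEquiv.measurableEmbedding (⟨⟨R, R, hRinv, hRinv⟩, hRmp.measurable, hRmp.measurable⟩ :
      (ℝ × ℝ) ≃ᵐ (ℝ × ℝ))
  set g : ℝ × ℝ → ℝ := fun z => f z.1 * f z.2 with hg
  have hg0 : ∀ z, 0 ≤ g z := fun z => mul_nonneg (hf.nonneg _) (hf.nonneg _)
  have hgm : Measurable g := by fun_prop
  have hprod : ν.prod ν = volume.withDensity fun z => ENNReal.ofReal (g z) := by
    rw [hν, prod_withDensity (by fun_prop) (by fun_prop), ← Measure.volume_eq_prod]
    simp only [hg, ENNReal.ofReal_mul (hf.nonneg _)]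
  set K : ℝ × ℝ → ℝ := fun z => ψ (z.1 ^ 2) + ψ (z.2 ^ 2) with hK
  have hcoord1 : Integrable (fun z : ℝ × ℝ => ψ (z.1 ^ 2)) (ν.prod ν) := by
    simpa using hint 1 0
  have hcoord2 : Integrable (fun z : ℝ × ℝ => ψ (z.2 ^ 2)) (ν.prod ν) := by
    simpa using hint 0 1
  have hrot1 := hint c s
  have hrot2 : Integrable (fun z : ℝ × ℝ => ψ ((s * z.1 - c * z.2) ^ 2)) (ν.prod ν) := by
    simpa [sub_eq_add_neg] using hint s (-c)
  have hsymm : MeasurePreserving (fun x : ℝ => -x) ν ν :=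
    ⟨measurable_neg, by rw [hν]; exact hf.isSymmUnimodal.map_neg⟩
  -- The quarter turn shows that the two coordinates of `R z` contribute equally to the integral of
  -- `K ∘ R`.
  have hquarter : MeasurePreserving (fun z : ℝ × ℝ => (z.2, -z.1)) (ν.prod ν) (ν.prod ν) :=
    ((MeasurePreserving.id ν).prod hsymm).comp Measure.measurePreserving_swap
  have e1 : ∫ z, K z ∂(ν.prod ν) = 2 * ∫ x, ψ (x ^ 2) ∂ν := by
    rw [hK, integral_add hcoord1 hcoord2, integral_fun_fst (fun x => ψ (x ^ 2)),
      integral_fun_snd (fun x => ψ (x ^ 2))]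
    simp; ring
  have e2 : ∫ z, K (R z) ∂(ν.prod ν) =
      2 * ∫ z : ℝ × ℝ, ψ ((c * z.1 + s * z.2) ^ 2) ∂(ν.prod ν) := by
    simp only [hK, hRapp]
    rw [integral_add hrot1 hrot2, two_mul]
    congr 1
    have hqe : MeasurableEmbedding (fun z : ℝ × ℝ => (z.2, -z.1)) :=
      ((MeasurableEquiv.prodComm).trans
        ((MeasurableEquiv.refl ℝ).prodCongr (MeasurableEquiv.neg ℝ))).measurableEmbedding
    rw [← hquarter.integral_comp hqe]
    refine integral_congr_ae (ae_of_all _ fun z => ?_)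
    simp only
    ring_nf
  have hKi : Integrable K (ν.prod ν) := hcoord1.add hcoord2
  have hKRi : Integrable (fun z => K (R z)) (ν.prod ν) := by
    simp only [hK, hRapp]
    exact hrot1.add hrot2
  set Δ : ℝ × ℝ → ℝ := fun z => K (R z) - K z with hΔ
  have hΔi : Integrable Δ (ν.prod ν) := hKRi.sub hKi
  have hlt : ∀ᵐ z ∂(volume : Measure (ℝ × ℝ)), ENNReal.ofReal (g z) < ∞ :=
    ae_of_all _ fun z => ENNReal.ofReal_lt_top
  have hgΔ : Integrable (fun z => g z * Δ z) := by
    rw [hprod, integrable_withDensity_iff_integrable_smul' (by fun_prop) hlt] at hΔi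
    simpa [ENNReal.toReal_ofReal, hg0] using hΔi
  have e3 : ∫ z, Δ z ∂(ν.prod ν) = ∫ z, g z * Δ z := by
    rw [hprod, integral_withDensity_eq_integral_toReal_smul (by fun_prop) hlt]
    simp [ENNReal.toReal_ofReal, hg0]
  have hΔR : ∀ z, Δ (R z) = -Δ z := by
    intro z
    simp only [hΔ, hRinv]
    ring
  have hgRΔ : Integrable (fun z => g (R z) * Δ z) := by
    have := (hRmp.integrable_comp_emb hRe).2 hgΔ
    refine this.neg.congr (ae_of_all _ fun z => ?_)
    simp [hΔR]
  have e4 : ∫ z, g (R z) * Δ z = -∫ z, g z * Δ z := by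
    rw [← hRmp.integral_comp hRe, ← integral_neg]
    refine integral_congr_ae (ae_of_all _ fun z => ?_)
    simp [hΔR, hRinv]
  -- By `e4` this integral is twice that of `g Δ`. The factors `g z - g (R z)` and `Δ z` have the
  -- same sign, whichever of `z` and `R z` is more spread.
  have e5 : 0 ≤ ∫ z, (g z * Δ z - g (R z) * Δ z) := by
    refine integral_nonneg fun z => ?_
    have hsq : z.1 ^ 2 + z.2 ^ 2 = (R z).1 ^ 2 + (R z).2 ^ 2 := by
      rw [hRapp]
      simp only
      linear_combination (-(z.1 ^ 2 + z.2 ^ 2)) * h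
    rw [Pi.zero_apply, ← sub_mul]
    rcases le_total (max (z.1 ^ 2) (z.2 ^ 2)) (max ((R z).1 ^ 2) ((R z).2 ^ 2)) with hm | hm
    · exact mul_nonneg (sub_nonneg.2 (hf.mul_le_mul_of_max_sq hsq hm))
        (sub_nonneg.2 (hψ.add_le_add_of_max_sq hsq hm))
    · exact mul_nonneg_of_nonpos_of_nonpos (sub_nonpos.2 (hf.mul_le_mul_of_max_sq hsq.symm hm))
        (sub_nonpos.2 (hψ.add_le_add_of_max_sq hsq.symm hm))
  rw [integral_sub hgΔ hgRΔ, e4, ← e3, hΔ, integral_sub hKRi hKi, e1, e2] at e5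
  linarith

/-! ### Comparison with the Gaussian by counting sign changes. -/

open Set in
/-- A function with an order-connected negativity set on the half-line either has a nonnegative
product with the deviation of a given convex function from some affine function, or it has a
constant sign after multiplication by an affine function. -/
theorem ConvexOn.exists_affine_mul_nonneg {ψ δ : ℝ → ℝ} (hψ : ConvexOn ℝ (Ici 0) ψ)
    (hδ : OrdConnected {t | 0 ≤ t ∧ δ t < 0}) :
    (∃ a b : ℝ, ∀ t, 0 ≤ t → 0 ≤ (ψ t - (a + b * t)) * δ t) ∨
    ∃ a b t₀ : ℝ, ∀ t, 0 ≤ t → t ≠ t₀ → a + b * t ≠ 0 ∧ 0 ≤ (a + b * t) * δ t := by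
  set I := {t | 0 ≤ t ∧ δ t < 0} with hI
  have hnot : ∀ t, 0 ≤ t → t ∉ I → 0 ≤ δ t := by
    intro t ht h
    by_contra! hlt
    exact h ⟨ht, hlt⟩
  rcases I.eq_empty_or_nonempty with he | hne
  · right
    refine ⟨1, 0, 0, fun t ht _ => ⟨by simp, ?_⟩⟩
    have := hnot t ht (by rw [he]; simp)
    simpa using this
  have hbb : BddBelow I := ⟨0, fun t ht => ht.1⟩
  have hα0 : 0 ≤ sInf I := le_csInf hne fun t ht => ht.1
  have hltα : ∀ t, 0 ≤ t → t < sInf I → 0 ≤ δ t := fun t ht h =>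
    hnot t ht (notMem_of_lt_csInf h hbb)
  by_cases hba : BddAbove I
  · have hgtβ : ∀ t, 0 ≤ t → sSup I < t → 0 ≤ δ t := fun t ht h =>
      hnot t ht (notMem_of_csSup_lt h hba)
    have hmid : ∀ t, sInf I < t → t < sSup I → δ t < 0 := by
      intro t h1 h2
      obtain ⟨u, hu, hut⟩ := exists_lt_of_csInf_lt hne h1
      obtain ⟨v, hv, htv⟩ := exists_lt_of_lt_csSup hne h2
      exact (hδ.out hu hv ⟨hut.le, htv.le⟩).2
    have hαβ : sInf I ≤ sSup I := csInf_le_csSup hne hbb hba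
    rcases hαβ.eq_or_lt with hαβ | hαβ
    · right
      refine ⟨1, 0, sInf I, fun t ht hne => ⟨by simp, ?_⟩⟩
      rcases lt_or_gt_of_ne hne with h | h
      · simpa using hltα t ht h
      · simpa using hgtβ t ht (hαβ ▸ h)
    · left
      set α := sInf I
      set β := sSup I
      -- The affine function is the chord of `ψ` between the endpoints of the negativity interval:
      -- `ψ` lies below it inside and above it outside, matching the sign of `δ`.
      set m := (ψ β - ψ α) / (β - α) with hm
      refine ⟨ψ α - m * α, m, fun t ht => ?_⟩
      have hβα : 0 < β - α := by linarith
      rcases eq_or_ne t α with rfl | htα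
      · simp
      rcases eq_or_ne t β with rfl | htβ
      · have : ψ β - (ψ α - m * α + m * β) = 0 := by rw [hm]; field_simp; ring
        rw [this]; simp
      have hβ0 : 0 ≤ β := by linarith
      have key : ψ t - (ψ α - m * α + m * t) = ((ψ t - ψ α) / (t - α) - m) * (t - α) := by
        have : t - α ≠ 0 := sub_ne_zero.2 htα
        field_simp
        ring
      rw [key]
      rcases lt_or_gt_of_ne htβ with h | h
      · have hs := hψ.secant_mono (a := α) (x := t) (y := β) hα0 ht hβ0 htα hαβ.ne' h.le
        rcases lt_or_gt_of_ne htα with h' | h'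
        · exact mul_nonneg (mul_nonneg_of_nonpos_of_nonpos (by linarith) (by linarith))
            (hltα t ht h')
        · exact mul_nonneg_of_nonpos_of_nonpos
            (mul_nonpos_of_nonpos_of_nonneg (by linarith) (by linarith)) (hmid t h' h).le
      · have hs := hψ.secant_mono (a := α) (x := β) (y := t) hα0 hβ0 ht hαβ.ne' htα h.le
        exact mul_nonneg (mul_nonneg (by linarith) (by linarith)) (hgtβ t ht h)
  · right
    -- When `δ` stays negative up to infinity, the affine function `sInf I - t` changes sign exactly
    -- where `δ` does.
    refine ⟨sInf I, -1, sInf I, fun t ht hne' => ⟨fun h => hne' (by linarith), ?_⟩⟩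
    rcases lt_or_gt_of_ne hne' with h | h
    · exact mul_nonneg (by linarith) (hltα t ht h)
    · obtain ⟨u, hu, hut⟩ := exists_lt_of_csInf_lt hne h
      obtain ⟨v, hv, htv⟩ := not_bddAbove_iff.1 hba t
      exact mul_nonneg_of_nonpos_of_nonpos (by linarith) (hδ.out hu hv ⟨hut.le, htv.le⟩).2.le

open ProbabilityTheory Set in
/-- A square-log-concave density is dominated by the centered Gaussian of the same variance, when
tested on convex functions of the square. -/
theorem IsSqLogConcaveDensity.integral_le_gaussianReal {f : ℝ → ℝ}
    (hf : IsSqLogConcaveDensity f) {ν : Measure ℝ}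
    (hν : ν = volume.withDensity fun x => ENNReal.ofReal (f x)) [IsProbabilityMeasure ν]
    {v : NNReal} (hv0 : v ≠ 0) (hx2 : Integrable (fun x : ℝ => x ^ 2) ν)
    (hv : ∫ x, x ^ 2 ∂ν = v) {ψ : ℝ → ℝ} (hψ : ConvexOn ℝ (Ici 0) ψ)
    (hψν : Integrable (fun x : ℝ => ψ (x ^ 2)) ν)
    (hψγ : Integrable (fun x : ℝ => ψ (x ^ 2)) (gaussianReal 0 v)) :
    ∫ x, ψ (x ^ 2) ∂ν ≤ ∫ x, ψ (x ^ 2) ∂(gaussianReal 0 v) := by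
  have hfm := hf.measurable
  have hvpos : (0 : ℝ) < v := lt_of_le_of_ne v.2 (by exact_mod_cast hv0.symm)
  set G : ℝ → ℝ := gaussianPDFReal 0 v with hG
  have hγ : gaussianReal 0 v = volume.withDensity fun x => ENNReal.ofReal (G x) :=
    gaussianReal_of_var_ne_zero 0 hv0
  have hGm : Measurable G := measurable_gaussianPDFReal 0 v
  have hG0 : ∀ x, 0 ≤ G x := gaussianPDFReal_nonneg 0 v
  have tr : ∀ (g : ℝ → ℝ), Measurable g → (∀ x, 0 ≤ g x) → ∀ φ : ℝ → ℝ,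
      Integrable φ (volume.withDensity fun x => ENNReal.ofReal (g x)) →
      Integrable (fun x => φ x * g x) ∧
        ∫ x, φ x ∂(volume.withDensity fun x => ENNReal.ofReal (g x)) = ∫ x, φ x * g x := by
    intro g hgm hg0 φ hφ
    have hlt : ∀ᵐ z ∂(volume : Measure ℝ), ENNReal.ofReal (g z) < ∞ :=
      ae_of_all _ fun z => ENNReal.ofReal_lt_top
    constructor
    · rw [integrable_withDensity_iff_integrable_smul' (by fun_prop) hlt] at hφ
      simpa [ENNReal.toReal_ofReal, hg0, mul_comm] using hφ
    · rw [integral_withDensity_eq_integral_toReal_smul (by fun_prop) hlt]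
      simp [ENNReal.toReal_ofReal, hg0, mul_comm]
  set δ : ℝ → ℝ := fun x => G x - f x with hδ
  have hδi : ∀ φ : ℝ → ℝ, Integrable φ ν → Integrable φ (gaussianReal 0 v) →
      Integrable (fun x => φ x * δ x) ∧
        ∫ x, φ x * δ x = ∫ x, φ x ∂(gaussianReal 0 v) - ∫ x, φ x ∂ν := by
    intro φ h1 h2
    rw [hν] at h1 ⊢
    rw [hγ] at h2 ⊢
    obtain ⟨i1, e1⟩ := tr f hfm hf.nonneg φ h1
    obtain ⟨i2, e2⟩ := tr G hGm hG0 φ h2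
    simp only [hδ, mul_sub]
    exact ⟨i2.sub i1, by rw [integral_sub i2 i1, e1, e2]⟩
  have hx2γ : Integrable (fun x : ℝ => x ^ 2) (gaussianReal 0 v) :=
    (memLp_id_gaussianReal 2).integrable_sq
  have hvγ : ∫ x, x ^ 2 ∂(gaussianReal 0 v) = v := by
    have := variance_id_gaussianReal (μ := 0) (v := v)
    rw [variance_eq_integral aemeasurable_id] at this
    simpa using this
  have haff : ∀ a b : ℝ, Integrable (fun x => (a + b * x ^ 2) * δ x) ∧
      ∫ x, (a + b * x ^ 2) * δ x = 0 := by
    intro a b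
    have i1 : Integrable (fun x : ℝ => a + b * x ^ 2) ν := (integrable_const a).add (hx2.const_mul b)
    have i2 : Integrable (fun x : ℝ => a + b * x ^ 2) (gaussianReal 0 v) :=
      (integrable_const a).add (hx2γ.const_mul b)
    refine ⟨(hδi _ i1 i2).1, ?_⟩
    rw [(hδi _ i1 i2).2, integral_add (integrable_const a) (hx2.const_mul b),
      integral_add (integrable_const a) (hx2γ.const_mul b), integral_const_mul, integral_const_mul,
      hv, hvγ]
    simp
  have hδs : ∀ x, δ √(x ^ 2) = δ x := by
    intro x
    simp only [hδ, hf.apply_sqrt_sq, hG, gaussianPDFReal_def, sub_zero, Real.sq_sqrt (sq_nonneg x)]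
  -- In the variable `t = x²` the Gaussian gives equality in the log-concavity inequality (`h4`), so
  -- `f > G` at two points forces it in between.
  have hord : OrdConnected {t | 0 ≤ t ∧ δ √t < 0} := by
    refine ⟨fun s hs u hu t ht => ?_⟩
    rcases ht.1.eq_or_lt with rfl | hst
    · exact hs
    rcases ht.2.eq_or_lt with rfl | htu
    · exact hu
    refine ⟨hs.1.trans ht.1, ?_⟩
    have hsu : 0 < u - s := by linarith
    set a := (u - t) / (u - s) with ha
    set b := (t - s) / (u - s) with hb
    have ha0 : 0 < a := div_pos (by linarith) hsu
    have hb0 : 0 < b := div_pos (by linarith) hsu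
    have hab : a + b = 1 := by rw [ha, hb]; field_simp; ring
    have ht' : t = a * s + b * u := by rw [ha, hb]; field_simp; ring
    have hlc := hf.logConcave s u a b hs.1 hu.1 ha0 hb0 hab
    have h1 : G √s < f √s := by have := hs.2; simp only [hδ] at this; linarith
    have h2 : G √u < f √u := by have := hu.2; simp only [hδ] at this; linarith
    have h3 : G √s ^ a * G √u ^ b < f √s ^ a * f √u ^ b :=
      mul_lt_mul'' (Real.rpow_lt_rpow (hG0 _) h1 ha0) (Real.rpow_lt_rpow (hG0 _) h2 hb0)
        (Real.rpow_nonneg (hG0 _) _) (Real.rpow_nonneg (hG0 _) _)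
    have h4 : G √s ^ a * G √u ^ b = G √t := by
      simp only [hG, gaussianPDFReal_def, sub_zero, Real.sq_sqrt hs.1, Real.sq_sqrt hu.1,
        Real.sq_sqrt (hs.1.trans ht.1)]
      set C := (√(2 * Real.pi * v))⁻¹ with hC
      have hC0 : 0 ≤ C := by positivity
      rw [Real.mul_rpow hC0 (Real.exp_pos _).le, Real.mul_rpow hC0 (Real.exp_pos _).le,
        ← Real.exp_mul, ← Real.exp_mul, mul_mul_mul_comm, ← Real.rpow_add_of_nonneg hC0 ha0.le hb0.le,
        hab, Real.rpow_one, ← Real.exp_add]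
      congr 2
      rw [ht']
      ring
    simp only [hδ]
    rw [← ht'] at hlc
    linarith
  rcases hψ.exists_affine_mul_nonneg (δ := fun t => δ √t) hord with ⟨a, b, hab⟩ | ⟨a, b, t₀, hab⟩
  · have h1 : 0 ≤ ∫ x, (ψ (x ^ 2) * δ x - (a + b * x ^ 2) * δ x) := by
      refine integral_nonneg fun x => ?_
      have := hab (x ^ 2) (sq_nonneg x)
      rw [hδs] at this
      simpa [sub_mul] using this
    rw [integral_sub (hδi _ hψν hψγ).1 (haff a b).1, (haff a b).2, (hδi _ hψν hψγ).2] at h1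
    linarith
  -- Here an affine multiple of `δ` is nonnegative with integral zero, so the two densities coincide
  -- almost everywhere.
  · have hae : ∀ᵐ x : ℝ, x ^ 2 ≠ t₀ := by
      have hfin : {x : ℝ | x ^ 2 = t₀}.Finite := by
        refine (Set.toFinite {√t₀, -√t₀}).subset fun x hx => ?_
        have hx : x ^ 2 = t₀ := hx
        have : x ^ 2 = √t₀ ^ 2 := by rw [Real.sq_sqrt (hx ▸ sq_nonneg x), hx]
        simpa using sq_eq_sq_iff_eq_or_eq_neg.1 this
      have := hfin.measure_zero volume
      rw [ae_iff]
      simpa using this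
    have hnn : 0 ≤ᵐ[volume] fun x => (a + b * x ^ 2) * δ x := by
      filter_upwards [hae] with x hx
      have := (hab (x ^ 2) (sq_nonneg x) hx).2
      rwa [hδs] at this
    have hz := (integral_eq_zero_iff_of_nonneg_ae hnn (haff a b).1).1 (haff a b).2
    have hδ0 : δ =ᵐ[volume] 0 := by
      filter_upwards [hz, hae] with x hx hx'
      exact (mul_eq_zero.1 hx).resolve_left (hab (x ^ 2) (sq_nonneg x) hx').1
    have : ∫ x, ψ (x ^ 2) * δ x = 0 := by
      rw [integral_eq_zero_of_ae]
      filter_upwards [hδ0] with x hx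
      simp [hx]
    rw [(hδi _ hψν hψγ).2] at this
    linarith

/-! ### Changing summands beside an independent unimodal remainder. -/

/-- A symmetric unimodal probability measure with a finite `p`-th moment. -/
structure IsUnimodalLaw (p : ℝ) (μ : Measure ℝ) : Prop where
  prob : IsProbabilityMeasure μ
  unimodal : IsSymmUnimodal μ
  memLp : MemLp (fun s : ℝ => s) (ENNReal.ofReal p) μ

theorem memLp_add_prod {p : ℝ} {ρ μ : Measure ℝ} (hρ : IsUnimodalLaw p ρ)
    (hμ : IsUnimodalLaw p μ) (a b : ℝ) :
    MemLp (fun z : ℝ × ℝ => a * z.1 + b * z.2) (ENNReal.ofReal p) (ρ.prod μ) := by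
  have := hρ.prob
  have := hμ.prob
  exact ((hρ.memLp.comp_fst μ).const_mul a).add ((hμ.memLp.comp_snd ρ).const_mul b)

theorem IsUnimodalLaw.conv {p : ℝ} {ρ μ : Measure ℝ} (hρ : IsUnimodalLaw p ρ)
    (hμ : IsUnimodalLaw p μ) : IsUnimodalLaw p (ρ.conv μ) := by
  have := hρ.prob
  have := hμ.prob
  refine ⟨inferInstance, hρ.unimodal.conv hμ.unimodal, ?_⟩
  refine (memLp_map_measure_iff aestronglyMeasurable_id (by fun_prop)).2 ?_
  simpa [Function.comp_def] using memLp_add_prod hρ hμ 1 1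

theorem IsUnimodalLaw.map_const_mul {p : ℝ} {μ : Measure ℝ} (hμ : IsUnimodalLaw p μ) (a : ℝ) :
    IsUnimodalLaw p (μ.map (a * ·)) := by
  have := hμ.prob
  refine ⟨Measure.isProbabilityMeasure_map (by fun_prop), hμ.unimodal.map_const_mul a, ?_⟩
  exact (memLp_map_measure_iff aestronglyMeasurable_id (by fun_prop)).2 (hμ.memLp.const_mul a)

theorem isUnimodalLaw_dirac (p : ℝ) : IsUnimodalLaw p (Measure.dirac 0) := by
  refine ⟨inferInstance, Or.inl rfl, ?_⟩
  refine (MemLp.ae_eq (f := fun _ => (0 : ℝ)) ?_ MemLp.zero')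
  exact (ae_dirac_iff (measurableSet_eq_fun measurable_const measurable_id)).2 rfl

open ProbabilityTheory in
theorem isUnimodalLaw_gaussianReal (p : ℝ) (v : NNReal) : IsUnimodalLaw p (gaussianReal 0 v) := by
  refine ⟨inferInstance, ?_, memLp_id_gaussianReal' _ ENNReal.ofReal_ne_top⟩
  rcases eq_or_ne v 0 with rfl | hv
  · left; simp
  · refine Or.inr ⟨gaussianPDF 0 v, ⟨measurable_gaussianPDF 0 v, ENNReal.ofReal_ne_top, ?_⟩,
      gaussianReal_of_var_ne_zero 0 hv⟩
    intro x y hxy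
    refine ENNReal.ofReal_le_ofReal ?_
    simp only [gaussianPDFReal_def, sub_zero]
    have := sq_le_sq.2 hxy
    gcongr

/-- The `p`-th absolute moment of `√t + S`, where `S` has law `μ`. -/
noncomputable def shiftedMoment (p : ℝ) (μ : Measure ℝ) (t : ℝ) : ℝ := ∫ s, |√t + s| ^ p ∂μ

/-- By symmetry of `μ` the sign of the shift is irrelevant, so conditioning on the other summands
leaves a function of their square alone. -/
theorem shiftedMoment_sq {p : ℝ} {μ : Measure ℝ} (hμ : IsSymmUnimodal μ) (x : ℝ) :
    shiftedMoment p μ (x ^ 2) = ∫ s, |x + s| ^ p ∂μ := by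
  rw [shiftedMoment, Real.sqrt_sq_eq_abs]
  rcases abs_choice x with h | h
  · rw [h]
  · rw [h]
    have hmp : MeasurePreserving (fun s : ℝ => -s) μ μ := ⟨measurable_neg, hμ.map_neg⟩
    rw [← hmp.integral_comp (MeasurableEquiv.neg ℝ).measurableEmbedding]
    refine integral_congr_ae (ae_of_all _ fun s => ?_)
    simp only
    rw [← neg_add, abs_neg]

section
variable {p : ℝ} (hp : 1 ≤ p)
include hp

theorem integrable_shiftedMoment {α : Type*} [MeasurableSpace α] {P : Measure α} [SFinite P]
    {μ : Measure ℝ} (hμ : IsUnimodalLaw p μ) {g : α → ℝ}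
    (hg : MemLp (fun z : α × ℝ => g z.1 + z.2) (ENNReal.ofReal p) (P.prod μ)) :
    Integrable (fun x => shiftedMoment p μ (g x ^ 2)) P := by
  have := hμ.prob
  simp only [shiftedMoment_sq hμ.unimodal]
  exact (hg.integrable_abs_rpow (by linarith)).integral_prod_left

theorem integrable_shiftedMoment_sq {ρ μ : Measure ℝ} (hρ : IsUnimodalLaw p ρ)
    (hμ : IsUnimodalLaw p μ) (a : ℝ) :
    Integrable (fun x : ℝ => shiftedMoment p μ ((a * x) ^ 2)) ρ := by
  have := hρ.prob
  refine integrable_shiftedMoment hp hμ (g := fun x => a * x) ?_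
  simpa using memLp_add_prod hρ hμ a 1

theorem integral_conv_eq_shiftedMoment {ρ μ : Measure ℝ} (hρ : IsUnimodalLaw p ρ)
    (hμ : IsUnimodalLaw p μ) :
    ∫ s, |s| ^ p ∂(ρ.conv μ) = ∫ x, shiftedMoment p μ (x ^ 2) ∂ρ := by
  have := hρ.prob
  have := hμ.prob
  have hm : Measurable fun s : ℝ => |s| ^ p := by fun_prop
  rw [Measure.conv, integral_map (by fun_prop) hm.aestronglyMeasurable,
    integral_prod _ ((by simpa using memLp_add_prod hρ hμ 1 1 :
      MemLp (fun z : ℝ × ℝ => z.1 + z.2) (ENNReal.ofReal p) (ρ.prod μ)).integrable_abs_rpow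
        (by linarith))]
  simp only [shiftedMoment_sq hμ.unimodal]

omit hp in
theorem measurable_shiftedMoment {μ : Measure ℝ} (hμ : IsUnimodalLaw p μ) :
    Measurable (shiftedMoment p μ) := by
  have := hμ.prob
  refine (StronglyMeasurable.integral_prod_right (f := fun t s : ℝ => |√t + s| ^ p) ?_).measurable
  exact Measurable.stronglyMeasurable (by unfold Function.uncurry; fun_prop)

theorem integral_map_mul_conv {ρ μ : Measure ℝ} (hρ : IsUnimodalLaw p ρ)
    (hμ : IsUnimodalLaw p μ) (a : ℝ) :
    ∫ s, |s| ^ p ∂((ρ.map (a * ·)).conv μ) = ∫ x, shiftedMoment p μ ((a * x) ^ 2) ∂ρ := by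
  rw [integral_conv_eq_shiftedMoment hp (hρ.map_const_mul a) hμ, integral_map (by fun_prop)]
  exact ((measurable_shiftedMoment hμ).comp (by fun_prop)).aestronglyMeasurable

variable {ε : ℝ} (hε : (2 ≤ p ∧ ε = 1) ∨ (p ≤ 2 ∧ ε = -1))
include hε

theorem convexOn_shiftedMoment {μ : Measure ℝ} (hμ : IsUnimodalLaw p μ) (a : ℝ) :
    ConvexOn ℝ (Set.Ici 0) fun t : ℝ => ε * shiftedMoment p μ (a ^ 2 * t) := by
  have := hμ.prob
  have h := hμ.unimodal.convexOn hp hε hμ.memLp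
  refine ⟨convex_Ici 0, fun t ht u hu c d hc hd hcd => ?_⟩
  have ht' : (0 : ℝ) ≤ t := ht
  have hu' : (0 : ℝ) ≤ u := hu
  have := h.2 (show a ^ 2 * t ∈ Set.Ici 0 by simp; positivity)
    (show a ^ 2 * u ∈ Set.Ici 0 by simp; positivity) hc hd hcd
  simp only [smul_eq_mul] at this ⊢
  rw [show a ^ 2 * (c * t + d * u) = c * (a ^ 2 * t) + d * (a ^ 2 * u) by ring]
  exact this

variable {f : ℝ → ℝ} (hf : IsSqLogConcaveDensity f) {ν : Measure ℝ}
  (hν : ν = volume.withDensity fun x => ENNReal.ofReal (f x)) (hνl : IsUnimodalLaw p ν)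
include hf hν hνl

/-- After integrating out `μ`, this is the planar comparison for the unit vector `(b, a) / √(a² +
b²)` and a rescaled shifted moment. -/
theorem moment_merge_le {μ : Measure ℝ} (hμ : IsUnimodalLaw p μ) (a b : ℝ) :
    ε * ∫ s, |s| ^ p ∂((ν.map (√(a ^ 2 + b ^ 2) * ·)).conv μ) ≤
      ε * ∫ s, |s| ^ p ∂((ν.map (b * ·)).conv ((ν.map (a * ·)).conv μ)) := by
  have := hνl.prob
  have := hμ.prob
  have hzero : ∀ ρ : Measure ℝ, IsProbabilityMeasure ρ → (ν.map ((0 : ℝ) * ·)).conv ρ = ρ := by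
    intro ρ hρ
    simp [Measure.dirac_zero_conv]
  rcases (Real.sqrt_nonneg (a ^ 2 + b ^ 2)).eq_or_lt with hr | hr
  · have h0 : a ^ 2 + b ^ 2 = 0 := (Real.sqrt_eq_zero (by positivity)).1 hr.symm
    have ha : a = 0 := by nlinarith [sq_nonneg a, sq_nonneg b]
    have hb : b = 0 := by nlinarith [sq_nonneg a, sq_nonneg b]
    subst ha hb
    rw [← hr, hzero μ inferInstance, hzero μ inferInstance]
  set r := √(a ^ 2 + b ^ 2) with hrdef
  have hr2 : r ^ 2 = a ^ 2 + b ^ 2 := Real.sq_sqrt (by positivity)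
  have hsum : ∫ s, |s| ^ p ∂((ν.map (b * ·)).conv ((ν.map (a * ·)).conv μ)) =
      ∫ z : ℝ × ℝ, shiftedMoment p μ ((b * z.1 + a * z.2) ^ 2) ∂(ν.prod ν) := by
    rw [← Measure.conv_assoc]
    have hl := (hνl.map_const_mul b).conv (hνl.map_const_mul a)
    rw [integral_conv_eq_shiftedMoment hp hl hμ]
    have : (ν.map (b * ·)).conv (ν.map (a * ·)) =
        (ν.prod ν).map (fun z : ℝ × ℝ => b * z.1 + a * z.2) := by
      rw [Measure.conv, Measure.map_prod_map _ _ (by fun_prop) (by fun_prop),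
        Measure.map_map (by fun_prop) (by fun_prop)]
      rfl
    rw [this, integral_map (by fun_prop)]
    exact ((measurable_shiftedMoment hμ).comp (by fun_prop)).aestronglyMeasurable
  rw [hsum, integral_map_mul_conv hp hνl hμ]
  have key := hf.integral_le_integral_prod hν (convexOn_shiftedMoment hp hε hμ r) ?_
    (c := b / r) (s := a / r) (by field_simp; linarith)
  · rw [integral_const_mul, integral_const_mul] at key
    have e : ∀ z : ℝ × ℝ, r ^ 2 * (b / r * z.1 + a / r * z.2) ^ 2 = (b * z.1 + a * z.2) ^ 2 := by
      intro z
      field_simp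
    simp only [e] at key
    simpa only [mul_pow] using key
  · intro c s
    refine Integrable.const_mul ?_ ε
    have h1 : MemLp (fun z : (ℝ × ℝ) × ℝ => r * (c * z.1.1 + s * z.1.2) + z.2) (ENNReal.ofReal p)
        ((ν.prod ν).prod μ) :=
      (((memLp_add_prod hνl hνl c s).const_mul r).comp_fst μ).add (hμ.memLp.comp_snd (ν.prod ν))
    refine (integrable_shiftedMoment hp hμ
      (g := fun z : ℝ × ℝ => r * (c * z.1 + s * z.2)) h1).congr (ae_of_all _ fun z => ?_)
    simp only
    ring_nf

open ProbabilityTheory in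
theorem moment_le_gaussianReal {v : NNReal} (hv0 : v ≠ 0)
    (hx2 : Integrable (fun x : ℝ => x ^ 2) ν)
    (hv : ∫ x, x ^ 2 ∂ν = v) {μ : Measure ℝ} (hμ : IsUnimodalLaw p μ) (a : ℝ) :
    ε * ∫ s, |s| ^ p ∂((ν.map (a * ·)).conv μ) ≤
      ε * ∫ s, |s| ^ p ∂((gaussianReal 0 (Real.nnabs a ^ 2 * v)).conv μ) := by
  have := hνl.prob
  have hγ : gaussianReal 0 (Real.nnabs a ^ 2 * v) = (gaussianReal 0 v).map (a * ·) := by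
    rw [gaussianReal_map_const_mul, mul_zero]
    congr 2
    ext
    simp
  have hγl := isUnimodalLaw_gaussianReal p v
  rw [hγ, integral_map_mul_conv hp hνl hμ, integral_map_mul_conv hp hγl hμ]
  have key := hf.integral_le_gaussianReal hν hv0 hx2 hv (convexOn_shiftedMoment hp hε hμ a)
    (by simpa only [mul_pow] using (integrable_shiftedMoment_sq hp hνl hμ a).const_mul ε)
    (by simpa only [mul_pow] using (integrable_shiftedMoment_sq hp hγl hμ a).const_mul ε)
  rw [integral_const_mul, integral_const_mul] at key
  simpa only [mul_pow] using key

end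

/-! ### Weighted sums of independent variables. -/

/-- The law of `∑ aᵢ Yᵢ` for independent `Yᵢ` of law `ν`. -/
noncomputable def weightedSumLaw (ν : Measure ℝ) (n : ℕ) (a : Fin n → ℝ) : Measure ℝ :=
  (Measure.pi fun _ : Fin n => ν).map fun x => ∑ i, a i * x i

instance (ν : Measure ℝ) [IsProbabilityMeasure ν] (n : ℕ) (a : Fin n → ℝ) :
    IsProbabilityMeasure (weightedSumLaw ν n a) :=
  Measure.isProbabilityMeasure_map (Measurable.aemeasurable (by fun_prop))

theorem weightedSumLaw_zero (ν : Measure ℝ) (a : Fin 0 → ℝ) :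
    weightedSumLaw ν 0 a = Measure.dirac 0 := by
  simp [weightedSumLaw, Measure.pi_of_empty _ (fun i : Fin 0 => (0:ℝ)), Measure.map_dirac']

theorem weightedSumLaw_succ (ν : Measure ℝ) [IsProbabilityMeasure ν] (n : ℕ) (a : Fin (n + 1) → ℝ) :
    weightedSumLaw ν (n + 1) a =
      (weightedSumLaw ν n (fun i => a i.succ)).conv (ν.map (a 0 * ·)) := by
  rw [Measure.conv_comm]
  have h := measurePreserving_piFinSuccAbove (fun _ : Fin (n + 1) => ν) 0
  rw [weightedSumLaw, weightedSumLaw, Measure.conv,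
    Measure.map_prod_map _ _ (by fun_prop) (by fun_prop),
    Measure.map_map (by fun_prop) (by fun_prop)]
  rw [← h.map_eq, Measure.map_map (by fun_prop) h.measurable]
  congr 1
  ext x
  simp [Fin.sum_univ_succ, Fin.tail]

section
variable {p : ℝ} (hp : 1 ≤ p) {ε : ℝ} (hε : (2 ≤ p ∧ ε = 1) ∨ (p ≤ 2 ∧ ε = -1))
variable {f : ℝ → ℝ} (hf : IsSqLogConcaveDensity f) {ν : Measure ℝ}
  (hν : ν = volume.withDensity fun x => ENNReal.ofReal (f x)) (hνl : IsUnimodalLaw p ν)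

include hp hε hf hν hνl

/-- The remainder `μ` is arbitrary so that the induction can absorb the first summand into it,
collapse the other summands, and then merge the two terms left. -/
theorem moment_single_le_weightedSum (n : ℕ) (a : Fin n → ℝ) {μ : Measure ℝ}
    (hμ : IsUnimodalLaw p μ) :
    ε * ∫ s, |s| ^ p ∂((ν.map (√(∑ i, a i ^ 2) * ·)).conv μ) ≤
      ε * ∫ s, |s| ^ p ∂((weightedSumLaw ν n a).conv μ) := by
  have := hνl.prob
  induction n generalizing μ with
  | zero =>
    rw [weightedSumLaw_zero]
    simp
  | succ n ih =>
    have := hμ.prob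
    rw [weightedSumLaw_succ, Measure.conv_assoc]
    refine le_trans ?_ (ih (fun i => a i.succ) ((hνl.map_const_mul (a 0)).conv hμ))
    have h := moment_merge_le hp hε hf hν hνl hμ (a 0) √(∑ i : Fin n, a i.succ ^ 2)
    rw [Real.sq_sqrt (by positivity)] at h
    rwa [Fin.sum_univ_succ]

-- Summands are replaced one by one, as in Lindeberg's method. The Gaussian already obtained joins
-- the remainder, which stays unimodal.
open ProbabilityTheory in
theorem moment_weightedSum_le_gaussianReal {v : NNReal} (hv0 : v ≠ 0)
    (hx2 : Integrable (fun x : ℝ => x ^ 2) ν) (hv : ∫ x, x ^ 2 ∂ν = v) (n : ℕ) (a : Fin n → ℝ)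
    {μ : Measure ℝ} (hμ : IsUnimodalLaw p μ) :
    ε * ∫ s, |s| ^ p ∂((weightedSumLaw ν n a).conv μ) ≤
      ε * ∫ s, |s| ^ p ∂((gaussianReal 0 ((∑ i, Real.nnabs (a i) ^ 2) * v)).conv μ) := by
  have := hνl.prob
  induction n generalizing μ with
  | zero =>
    rw [weightedSumLaw_zero]
    simp
  | succ n ih =>
    have := hμ.prob
    have hγl := isUnimodalLaw_gaussianReal p ((∑ i : Fin n, Real.nnabs (a i.succ) ^ 2) * v)
    rw [weightedSumLaw_succ, Measure.conv_assoc]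
    refine (ih (fun i => a i.succ) ((hνl.map_const_mul (a 0)).conv hμ)).trans ?_
    rw [← Measure.conv_assoc, Measure.conv_comm (gaussianReal _ _), Measure.conv_assoc]
    refine (moment_le_gaussianReal hp hε hf hν hνl hv0 hx2 hv (hγl.conv hμ) (a 0)).trans_eq ?_
    rw [← Measure.conv_assoc, gaussianReal_conv_gaussianReal, add_zero, Fin.sum_univ_succ, add_mul]

end

/-! ### From the `ℓ_q^n` ball to independent coordinates. -/

open Set in
/-- A product of measures with densities has the product density. -/
theorem pi_withDensity_ofReal {n : ℕ} {f : ℝ → ℝ} (hf0 : ∀ x, 0 ≤ f x)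
    (hfi : Integrable f) :
    Measure.pi (fun _ : Fin n => volume.withDensity fun x => ENNReal.ofReal (f x)) =
      (volume : Measure (Fin n → ℝ)).withDensity fun x => ENNReal.ofReal (∏ i, f (x i)) := by
  have hfin : IsFiniteMeasure (volume.withDensity fun x => ENNReal.ofReal (f x)) :=
    isFiniteMeasure_withDensity_ofReal hfi.2
  refine Measure.pi_eq fun s hs => ?_
  have hpi : MeasurableSet (univ.pi s) := MeasurableSet.univ_pi hs
  have e : ∀ x : Fin n → ℝ, (univ.pi s).indicator (fun x => ENNReal.ofReal (∏ i, f (x i))) x =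
      ENNReal.ofReal (∏ i, (s i).indicator f (x i)) := by
    intro x
    classical
    by_cases hx : x ∈ univ.pi s
    · rw [indicator_of_mem hx]
      congr 1
      exact Finset.prod_congr rfl fun i _ => (indicator_of_mem (hx i (mem_univ i)) f).symm
    · rw [indicator_of_notMem hx]
      simp only [mem_pi, mem_univ, true_imp_iff, not_forall] at hx
      obtain ⟨i, hi⟩ := hx
      rw [Finset.prod_eq_zero (Finset.mem_univ i) (indicator_of_notMem hi f), ENNReal.ofReal_zero]
  have hind : ∀ i, Integrable ((s i).indicator f) := fun i => hfi.indicator (hs i)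
  have hind0 : ∀ i x, 0 ≤ (s i).indicator f x := fun i x => indicator_nonneg (fun x _ => hf0 x) x
  rw [withDensity_apply _ hpi, ← lintegral_indicator hpi, lintegral_congr e,
    ← ofReal_integral_eq_lintegral_ofReal (by exact Integrable.fintype_prod hind)
      (ae_of_all _ fun x => Finset.prod_nonneg fun i _ => hind0 i _),
    integral_fintype_prod_volume_eq_prod (fun i => (s i).indicator f),
    ENNReal.ofReal_prod_of_nonneg fun i _ => integral_nonneg (hind0 i)]
  refine Finset.prod_congr rfl fun i _ => ?_
  rw [withDensity_apply _ (hs i), integral_indicator (hs i),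
    ofReal_integral_eq_lintegral_ofReal hfi.integrableOn (ae_of_all _ hf0)]

open Set in
/-- Integration of a homogeneous function against `exp (-∑ |xᵢ|^q)`, in terms of its integral over
the unit ball. -/
theorem lintegral_homogeneous_mul_exp {n : ℕ} {q r : ℝ} (hq : 0 < q) (hr : 0 ≤ r)
    {Φ : (Fin n → ℝ) → ℝ≥0∞} (hΦm : Measurable Φ)
    (hΦ : ∀ t : ℝ, 0 < t → ∀ x, Φ (t • x) = ENNReal.ofReal (t ^ r) * Φ x) :
    ∫⁻ x, Φ x * ENNReal.ofReal (Real.exp (-∑ i, |x i| ^ q)) =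
      ENNReal.ofReal (Real.Gamma ((n + r) / q + 1)) * ∫⁻ x in {x | ∑ i, |x i| ^ q ≤ 1}, Φ x := by
  set N : (Fin n → ℝ) → ℝ := fun x => ∑ i, |x i| ^ q with hN
  have hNm : Measurable N := by fun_prop
  have hN0 : ∀ x, 0 ≤ N x := fun x => Finset.sum_nonneg fun i _ => by positivity
  have hNt : ∀ t : ℝ, 0 < t → ∀ x, N (t • x) = t ^ q * N x := by
    intro t ht x
    simp only [hN, Pi.smul_apply, smul_eq_mul, abs_mul, abs_of_pos ht, Finset.mul_sum]
    exact Finset.sum_congr rfl fun i _ => Real.mul_rpow ht.le (abs_nonneg _)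
  set E : ℝ → ℝ≥0∞ := fun s => ENNReal.ofReal (Real.exp (-s)) with hE
  have hEm : Measurable E := by fun_prop
  have hexp : ∀ x, E (N x) = ∫⁻ s in Ici 0, (Ici (N x)).indicator E s := by
    intro x
    rw [lintegral_indicator measurableSet_Ici, Measure.restrict_restrict measurableSet_Ici,
      inter_eq_left.2 (Ici_subset_Ici.2 (hN0 x)), setLIntegral_congr Ioi_ae_eq_Ici.symm,
      ← ofReal_integral_eq_lintegral_ofReal (integrableOn_exp_neg_Ioi (N x))
        (ae_of_all _ fun s => (Real.exp_pos _).le), integral_exp_neg_Ioi]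
  set B : Set (Fin n → ℝ) := {x | N x ≤ 1} with hB
  have hBm : MeasurableSet B := measurableSet_le hNm measurable_const
  -- The sublevel set is `s^(1/q) B`, so the volume contributes the exponent `n/q` and the
  -- homogeneity of `Φ` contributes `r/q`. Integration against `exp (-s)` then yields the Gamma
  -- value.
  have hscale : ∀ s : ℝ, 0 < s → ∫⁻ x, {x | N x ≤ s}.indicator Φ x =
      ENNReal.ofReal (s ^ ((n + r) / q)) * ∫⁻ x in B, Φ x := by
    intro s hs
    set t := s ^ (1 / q) with ht
    have ht0 : 0 < t := Real.rpow_pos_of_pos hs _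
    have htq : t ^ q = s := by rw [ht, ← Real.rpow_mul hs.le, one_div_mul_cancel hq.ne', Real.rpow_one]
    have hsm : MeasurableSet {x | N x ≤ s} := measurableSet_le hNm measurable_const
    have h1 : ∫⁻ y, {x | N x ≤ s}.indicator Φ (t • y) =
        ENNReal.ofReal (t ^ r) * ∫⁻ x in B, Φ x := by
      rw [← lintegral_indicator hBm, ← lintegral_const_mul _ (hΦm.indicator hBm)]
      refine lintegral_congr fun y => ?_
      have hiff : t • y ∈ {x | N x ≤ s} ↔ y ∈ B := by
        simp only [hB, mem_ofPred_eq, hNt t ht0, htq]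
        constructor
        · intro h
          by_contra! h'
          nlinarith
        · intro h
          nlinarith
      by_cases hy : y ∈ B
      · rw [indicator_of_mem hy, indicator_of_mem (hiff.2 hy), hΦ t ht0]
      · rw [indicator_of_notMem hy, indicator_of_notMem (fun h => hy (hiff.1 h)), mul_zero]
    have h2 : ∫⁻ y, {x | N x ≤ s}.indicator Φ (t • y) =
        ENNReal.ofReal ((t ^ n)⁻¹) * ∫⁻ x, {x | N x ≤ s}.indicator Φ x := by
      rw [← lintegral_map (hΦm.indicator hsm) (measurable_const_smul t),
        Measure.map_addHaar_smul _ ht0.ne', lintegral_smul_measure]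
      simp [abs_of_pos ht0]
    have htn : 0 < t ^ n := pow_pos ht0 n
    have h3 : ∫⁻ x, {x | N x ≤ s}.indicator Φ x =
        ENNReal.ofReal (t ^ n) * (ENNReal.ofReal ((t ^ n)⁻¹) * ∫⁻ x, {x | N x ≤ s}.indicator Φ x) := by
      rw [← mul_assoc, ← ENNReal.ofReal_mul htn.le, mul_inv_cancel₀ htn.ne', ENNReal.ofReal_one,
        one_mul]
    rw [h3, ← h2, h1, ← mul_assoc, ← ENNReal.ofReal_mul htn.le]
    congr 2
    rw [ht, ← Real.rpow_natCast, ← Real.rpow_mul hs.le, ← Real.rpow_mul hs.le, ← Real.rpow_add hs]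
    congr 1
    field_simp
  have hnr : 0 ≤ (n + r) / q := by positivity
  calc ∫⁻ x, Φ x * E (N x)
      = ∫⁻ x, ∫⁻ s in Ici 0, Φ x * (Ici (N x)).indicator E s := by
        refine lintegral_congr fun x => ?_
        rw [hexp, lintegral_const_mul _ (hEm.indicator measurableSet_Ici)]
    _ = ∫⁻ s in Ici (0 : ℝ), ∫⁻ x, Φ x * (Ici (N x)).indicator E s := by
        refine lintegral_lintegral_swap (Measurable.aemeasurable ?_)
        have : (Function.uncurry fun (x : Fin n → ℝ) (s : ℝ) => Φ x * (Ici (N x)).indicator E s) =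
            {z : (Fin n → ℝ) × ℝ | N z.1 ≤ z.2}.indicator (fun z => Φ z.1 * E z.2) := by
          ext z
          classical
          simp [Function.uncurry, indicator_apply]
        rw [this]
        exact Measurable.indicator (by fun_prop)
          (measurableSet_le (hNm.comp measurable_fst) measurable_snd)
    _ = ∫⁻ s in Ioi (0 : ℝ), ∫⁻ x, Φ x * (Ici (N x)).indicator E s :=
        setLIntegral_congr Ioi_ae_eq_Ici.symm
    _ = ∫⁻ s in Ioi (0 : ℝ), ENNReal.ofReal (Real.exp (-s) * s ^ ((n + r) / q + 1 - 1)) *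
          ∫⁻ x in B, Φ x := by
        refine setLIntegral_congr_fun measurableSet_Ioi fun s hs => ?_
        have : ∀ x, Φ x * (Ici (N x)).indicator E s = E s * {x | N x ≤ s}.indicator Φ x := by
          intro x
          classical
          simp [indicator_apply, mul_comm]
        rw [lintegral_congr this, lintegral_const_mul _
          (hΦm.indicator (measurableSet_le hNm measurable_const)), hscale s hs, ← mul_assoc,
          ← ENNReal.ofReal_mul (Real.exp_pos _).le, add_sub_cancel_right]
    _ = _ := by
        rw [lintegral_mul_const _ (by fun_prop), Real.Gamma_eq_integral (by linarith),
          ofReal_integral_eq_lintegral_ofReal (Real.GammaIntegral_convergent (by linarith))]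
        filter_upwards [self_mem_ae_restrict measurableSet_Ioi] with s hs
        have : (0 : ℝ) < s := hs
        positivity

theorem integral_abs_rpow_mul_exp {p q : ℝ} (hq : 0 < q) (hp : 0 ≤ p) :
    Integrable (fun x : ℝ => |x| ^ p * Real.exp (-|x| ^ q)) ∧
      ∫ x : ℝ, |x| ^ p * Real.exp (-|x| ^ q) = 2 / q * Real.Gamma ((p + 1) / q) := by
  constructor
  · have h := integrableOn_rpow_mul_exp_neg_rpow (p := q) (s := p) (by linarith) hq
    have := (integrable_fun_norm_addHaar (volume : Measure ℝ)
      (f := fun x : ℝ => x ^ p * Real.exp (-x ^ q))).2 (by simpa using h)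
    simpa using this
  · rw [integral_comp_abs (f := fun x => x ^ p * Real.exp (-x ^ q)),
      integral_rpow_mul_exp_neg_rpow hq (by linarith)]
    ring

/-- The probability density proportional to `exp (-|x|^q)`. -/
noncomputable def expPowerDensity (q x : ℝ) : ℝ :=
  (2 / q * Real.Gamma (1 / q))⁻¹ * Real.exp (-|x| ^ q)

section
variable {q : ℝ} (hq : 2 ≤ q)
include hq

theorem expPowerDensity_const_pos : 0 < (2 / q * Real.Gamma (1 / q))⁻¹ := by
  have := Real.Gamma_pos_of_pos (s := 1 / q) (by positivity)
  positivity

/-- This is where `q ≥ 2` matters: the exponent is `-u^(q/2)` in the variable `u = x²`, and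
`u^(q/2)` is convex. -/
theorem isSqLogConcaveDensity_expPower : IsSqLogConcaveDensity (expPowerDensity q) where
  measurable := by unfold expPowerDensity; fun_prop
  nonneg x := mul_nonneg (expPowerDensity_const_pos hq).le (Real.exp_pos _).le
  anti x y h := by
    have := (expPowerDensity_const_pos hq).le
    unfold expPowerDensity
    gcongr
  logConcave s t a b hs ht ha hb hab := by
    unfold expPowerDensity
    set C := (2 / q * Real.Gamma (1 / q))⁻¹
    have hC : 0 < C := expPowerDensity_const_pos hq
    have key : ∀ u : ℝ, 0 ≤ u → |√u| ^ q = u ^ (q / 2) := by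
      intro u hu
      rw [abs_of_nonneg (Real.sqrt_nonneg u), Real.sqrt_eq_rpow, ← Real.rpow_mul hu]
      ring_nf
    rw [key s hs, key t ht, key (a * s + b * t) (by positivity),
      Real.mul_rpow hC.le (Real.exp_pos _).le, Real.mul_rpow hC.le (Real.exp_pos _).le,
      ← Real.exp_mul, ← Real.exp_mul, mul_mul_mul_comm, ← Real.rpow_add hC, hab, Real.rpow_one,
      ← Real.exp_add]
    have h := (convexOn_rpow (by linarith : 1 ≤ q / 2)).2 (show s ∈ Set.Ici 0 from hs)
      (show t ∈ Set.Ici 0 from ht) ha.le hb.le hab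
    simp only [smul_eq_mul] at h
    gcongr
    linarith

theorem integrable_expPowerDensity : Integrable (expPowerDensity q) := by
  have := (integral_abs_rpow_mul_exp (p := 0) (q := q) (by linarith) le_rfl).1
  simp only [Real.rpow_zero, one_mul] at this
  exact this.const_mul _

theorem isProbabilityMeasure_expPower :
    IsProbabilityMeasure (volume.withDensity fun x => ENNReal.ofReal (expPowerDensity q x)) := by
  constructor
  have hC := expPowerDensity_const_pos hq
  have := (integral_abs_rpow_mul_exp (p := 0) (q := q) (by linarith) le_rfl).2
  simp only [Real.rpow_zero, one_mul, zero_add] at this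
  rw [withDensity_apply _ MeasurableSet.univ, Measure.restrict_univ,
    ← ofReal_integral_eq_lintegral_ofReal (integrable_expPowerDensity hq)
      (ae_of_all _ (isSqLogConcaveDensity_expPower hq).nonneg)]
  unfold expPowerDensity
  rw [integral_const_mul, this, inv_mul_cancel₀ (inv_pos.1 hC).ne', ENNReal.ofReal_one]

theorem isUnimodalLaw_expPower {p : ℝ} (hp : 0 < p) :
    IsUnimodalLaw p (volume.withDensity fun x => ENNReal.ofReal (expPowerDensity q x)) := by
  refine ⟨isProbabilityMeasure_expPower hq, (isSqLogConcaveDensity_expPower hq).isSymmUnimodal, ?_⟩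
  refine memLp_of_integrable_abs_rpow hp (by fun_prop) ?_
  have hm := (isSqLogConcaveDensity_expPower hq).measurable
  rw [integrable_withDensity_iff_integrable_smul' (by fun_prop)
    (ae_of_all _ fun z => ENNReal.ofReal_lt_top)]
  have := (integral_abs_rpow_mul_exp (p := p) (q := q) (by linarith) hp.le).1.const_mul
    (2 / q * Real.Gamma (1 / q))⁻¹
  refine this.congr (ae_of_all _ fun x => ?_)
  simp only
  rw [ENNReal.toReal_ofReal ((isSqLogConcaveDensity_expPower hq).nonneg x), smul_eq_mul,
    expPowerDensity]
  ring

open ProbabilityTheory in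
/-- The moments of a homogeneous function of a uniform vector on the `ℓ_q^n` ball, in terms of those
of a vector with independent coordinates of density proportional to `exp (-|x|^q)`. -/
theorem lintegral_cond_ball {n : ℕ} {r : ℝ} (hr : 0 ≤ r) {Φ : (Fin n → ℝ) → ℝ≥0∞}
    (hΦm : Measurable Φ)
    (hΦ : ∀ t : ℝ, 0 < t → ∀ x, Φ (t • x) = ENNReal.ofReal (t ^ r) * Φ x) :
    ENNReal.ofReal (Real.Gamma ((n + r) / q + 1)) *
      ∫⁻ x, Φ x ∂(cond volume {x : Fin n → ℝ | ∑ i, |x i| ^ q ≤ 1}) =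
    ENNReal.ofReal (Real.Gamma (n / q + 1)) *
      ∫⁻ x, Φ x ∂(Measure.pi fun _ : Fin n =>
        volume.withDensity fun x => ENNReal.ofReal (expPowerDensity q x)) := by
  have hq0 : 0 < q := by linarith
  have hprob := isProbabilityMeasure_expPower hq
  set C := (2 / q * Real.Gamma (1 / q))⁻¹ with hC
  have hC0 : 0 < C := expPowerDensity_const_pos hq
  have hden : ∀ x : Fin n → ℝ, ENNReal.ofReal (∏ i, expPowerDensity q (x i)) =
      ENNReal.ofReal (C ^ n) * ENNReal.ofReal (Real.exp (-∑ i, |x i| ^ q)) := by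
    intro x
    rw [← ENNReal.ofReal_mul (by positivity)]
    simp only [expPowerDensity, Finset.prod_mul_distrib, Finset.prod_const, Finset.card_univ,
      Fintype.card_fin, ← Real.exp_sum, Finset.sum_neg_distrib, ← hC]
  have hpi : ∀ {Ψ : (Fin n → ℝ) → ℝ≥0∞}, Measurable Ψ →
      ∫⁻ x, Ψ x ∂(Measure.pi fun _ : Fin n =>
        volume.withDensity fun x => ENNReal.ofReal (expPowerDensity q x)) =
      ENNReal.ofReal (C ^ n) * ∫⁻ x, Ψ x * ENNReal.ofReal (Real.exp (-∑ i, |x i| ^ q)) := by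
    intro Ψ hΨ
    rw [pi_withDensity_ofReal (isSqLogConcaveDensity_expPower hq).nonneg (integrable_expPowerDensity hq)]
    simp only [hden]
    rw [lintegral_withDensity_eq_lintegral_mul _ (by fun_prop) hΨ,
      ← lintegral_const_mul _ (by fun_prop)]
    refine lintegral_congr fun x => ?_
    simp only [Pi.mul_apply]
    ring
  -- The degree-zero case `Φ = 1` identifies the volume of the ball and thereby the normalization of
  -- the uniform law.
  have h1 := hpi (Ψ := fun _ => 1) measurable_const
  rw [lintegral_homogeneous_mul_exp hq0 (le_refl 0) measurable_const (by simp)] at h1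
  simp only [lintegral_const, measure_univ, mul_one, add_zero, one_mul,
    Measure.restrict_apply_univ] at h1
  have hvol : (volume {x : Fin n → ℝ | ∑ i, |x i| ^ q ≤ 1})⁻¹ =
      ENNReal.ofReal (C ^ n) * ENNReal.ofReal (Real.Gamma (n / q + 1)) := by
    refine (ENNReal.eq_inv_of_mul_eq_one_left ?_).symm
    rw [mul_assoc, ← h1]
  rw [hpi hΦm, lintegral_homogeneous_mul_exp hq0 hr hΦm hΦ, ProbabilityTheory.cond,
    lintegral_smul_measure, hvol, smul_eq_mul]
  ring

end

/-! ### The cube, `q = ∞`. -/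

/-- The uniform density on `[-1, 1]`. -/
noncomputable def uniformDensity : ℝ → ℝ := (Set.Icc (-1) 1).indicator fun _ => 1 / 2

theorem uniformDensity_of_le {x : ℝ} (h : |x| ≤ 1) : uniformDensity x = 1 / 2 :=
  Set.indicator_of_mem (s := Set.Icc (-1 : ℝ) 1) (abs_le.1 h) _

theorem uniformDensity_of_lt {x : ℝ} (h : 1 < |x|) : uniformDensity x = 0 :=
  Set.indicator_of_notMem (s := Set.Icc (-1 : ℝ) 1) (fun h' => h.not_ge (abs_le.2 h')) _

theorem isSqLogConcaveDensity_uniform : IsSqLogConcaveDensity uniformDensity where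
  measurable := measurable_const.indicator measurableSet_Icc
  nonneg x := Set.indicator_nonneg (fun _ _ => by norm_num) x
  anti x y h := by
    rcases le_or_gt |y| 1 with hy | hy
    · rw [uniformDensity_of_le hy, uniformDensity_of_le (h.trans hy)]
    · rw [uniformDensity_of_lt hy]
      exact Set.indicator_nonneg (fun _ _ => by norm_num) x
  logConcave s t a b hs ht ha hb hab := by
    have key : ∀ u : ℝ, |√u| ≤ 1 ↔ u ≤ 1 := fun u => by
      rw [abs_of_nonneg (Real.sqrt_nonneg u), Real.sqrt_le_one]
    have h0 : 0 ≤ uniformDensity √(a * s + b * t) := Set.indicator_nonneg (fun _ _ => by norm_num) _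
    rcases le_or_gt |√s| 1 with hs1 | hs1
    · rcases le_or_gt |√t| 1 with ht1 | ht1
      · have : |√(a * s + b * t)| ≤ 1 := by
          rw [key] at hs1 ht1 ⊢
          nlinarith
        rw [uniformDensity_of_le hs1, uniformDensity_of_le ht1, uniformDensity_of_le this,
          ← Real.rpow_add (by norm_num), hab, Real.rpow_one]
      · rwa [uniformDensity_of_lt ht1, Real.zero_rpow hb.ne', mul_zero]
    · rwa [uniformDensity_of_lt hs1, Real.zero_rpow ha.ne', zero_mul]

theorem withDensity_uniformDensity_apply {s : Set ℝ} (hs : MeasurableSet s) :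
    (volume.withDensity fun x => ENNReal.ofReal (uniformDensity x)) s =
      2⁻¹ * volume (Set.Icc (-1) 1 ∩ s) := by
  have : (fun x => ENNReal.ofReal (uniformDensity x)) =
      (Set.Icc (-1 : ℝ) 1).indicator fun _ => 2⁻¹ := by
    ext x
    rw [uniformDensity, Set.indicator_apply, Set.indicator_apply]
    split_ifs
    · rw [one_div, ENNReal.ofReal_inv_of_pos two_pos, ENNReal.ofReal_ofNat]
    · exact ENNReal.ofReal_zero
  rw [this, withDensity_apply _ hs, lintegral_indicator measurableSet_Icc,
    Measure.restrict_restrict measurableSet_Icc, setLIntegral_const]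

theorem isUnimodalLaw_uniform (p : ℝ) :
    IsUnimodalLaw p (volume.withDensity fun x => ENNReal.ofReal (uniformDensity x)) := by
  have hprob : IsProbabilityMeasure
      (volume.withDensity fun x => ENNReal.ofReal (uniformDensity x)) := by
    constructor
    rw [withDensity_uniformDensity_apply MeasurableSet.univ, Set.inter_univ, Real.volume_Icc]
    norm_num
    exact ENNReal.inv_mul_cancel two_ne_zero ENNReal.ofNat_ne_top
  refine ⟨hprob, isSqLogConcaveDensity_uniform.isSymmUnimodal, ?_⟩
  refine MemLp.of_bound (by fun_prop) 1 ?_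
  rw [ae_iff]
  have : {x : ℝ | ¬‖x‖ ≤ 1} = (Set.Icc (-1) 1)ᶜ := by
    ext x
    simp [abs_le]
  rw [this, withDensity_uniformDensity_apply measurableSet_Icc.compl, Set.inter_compl_self]
  simp

open ProbabilityTheory in
theorem cond_cube_eq_pi (n : ℕ) :
    cond volume {x : Fin n → ℝ | ∀ i, |x i| ≤ 1} =
      Measure.pi fun _ : Fin n => volume.withDensity fun x => ENNReal.ofReal (uniformDensity x) := by
  have hprob := (isUnimodalLaw_uniform 1).prob
  have hcube : {x : Fin n → ℝ | ∀ i, |x i| ≤ 1} = Set.univ.pi fun _ => Set.Icc (-1) 1 := by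
    ext x
    simp only [abs_le, Set.mem_pi, Set.mem_univ, true_imp_iff, Set.mem_ofPred_eq, Set.mem_Icc]
  refine (Measure.pi_eq fun s hs => ?_).symm
  rw [hcube, cond_apply (MeasurableSet.univ_pi fun _ => measurableSet_Icc), ← Set.pi_inter_distrib,
    volume_pi_pi, volume_pi_pi]
  simp only [fun i => withDensity_uniformDensity_apply (hs i), Finset.prod_mul_distrib,
    Real.volume_Icc, Finset.prod_const]
  congr 1
  rw [← ENNReal.inv_pow]
  norm_num

/-! ### Gaussian moments and two-sided norm bounds. -/

open ProbabilityTheory in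
theorem integral_abs_rpow_gaussianReal {p : ℝ} (hp : 1 ≤ p) (v : NNReal) :
    ∫ x, |x| ^ p ∂(gaussianReal 0 v) = (√v * gaussMoment p) ^ p := by
  have hp0 : 0 < p := by linarith
  have hγ : 0 ≤ Real.Gamma ((p + 1) / 2) / √Real.pi :=
    div_nonneg (Real.Gamma_pos_of_pos (by linarith)).le (Real.sqrt_nonneg _)
  have hstd : ∫ x, |x| ^ p ∂(gaussianReal 0 1) = gaussMoment p ^ p := by
    rw [integral_gaussianReal_eq_integral_smul one_ne_zero]
    have e : ∀ x : ℝ, gaussianPDFReal 0 1 x • |x| ^ p =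
        (√(2 * Real.pi))⁻¹ * (|x| ^ p * Real.exp (-(1 / 2) * |x| ^ (2 : ℝ))) := by
      intro x
      rw [gaussianPDFReal_def, Real.rpow_two, sq_abs]
      simp only [NNReal.coe_one, mul_one, sub_zero, smul_eq_mul]
      ring_nf
    simp only [e]
    rw [integral_const_mul,
      integral_comp_abs (f := fun x => x ^ p * Real.exp (-(1 / 2) * x ^ (2 : ℝ))),
      integral_rpow_mul_exp_neg_mul_rpow two_pos (by linarith) (by norm_num), gaussMoment,
      Real.mul_rpow (Real.sqrt_nonneg _) (Real.rpow_nonneg hγ _), ← Real.rpow_mul hγ,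
      one_div_mul_cancel hp0.ne', Real.rpow_one, Real.sqrt_mul zero_le_two]
    have h2 : (1 / 2 : ℝ) ^ (-(p + 1) / 2) = √2 ^ p * √2 := by
      rw [one_div, Real.inv_rpow zero_le_two, ← Real.rpow_neg zero_le_two, Real.sqrt_eq_rpow,
        ← Real.rpow_mul zero_le_two, ← Real.rpow_add two_pos]
      ring_nf
    rw [h2]
    have h3 : √2 ≠ 0 := by positivity
    have h4 : √Real.pi ≠ 0 := by positivity
    field_simp
  have hmap : gaussianReal 0 v = (gaussianReal 0 1).map (√v * ·) := by
    rw [gaussianReal_map_const_mul, mul_zero, mul_one]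
    congr 1
    ext
    simp
  have hm : Measurable fun x : ℝ => |x| ^ p := by fun_prop
  have hg : 0 ≤ gaussMoment p := mul_nonneg (Real.sqrt_nonneg _) (Real.rpow_nonneg hγ _)
  rw [hmap, integral_map (by fun_prop) hm.aestronglyMeasurable,
    Real.mul_rpow (Real.sqrt_nonneg _) hg, ← hstd, ← integral_const_mul]
  refine integral_congr_ae (ae_of_all _ fun x => ?_)
  simp only
  rw [abs_mul, abs_of_nonneg (Real.sqrt_nonneg _), Real.mul_rpow (Real.sqrt_nonneg _) (abs_nonneg _)]

theorem gaussMoment_nonneg {p : ℝ} (hp : 1 ≤ p) : 0 ≤ gaussMoment p :=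
  mul_nonneg (Real.sqrt_nonneg _) (Real.rpow_nonneg (div_nonneg
    (Real.Gamma_pos_of_pos (by linarith)).le (Real.sqrt_nonneg _)) _)

theorem integral_weightedSumLaw {ν : Measure ℝ} {n : ℕ} (a : Fin n → ℝ) (p : ℝ) :
    ∫ s, |s| ^ p ∂(weightedSumLaw ν n a) =
      ∫ x, |∑ i, a i * x i| ^ p ∂(Measure.pi fun _ : Fin n => ν) := by
  have hm : Measurable fun x : ℝ => |x| ^ p := by fun_prop
  rw [weightedSumLaw, integral_map (Measurable.aemeasurable (by fun_prop)) hm.aestronglyMeasurable]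

theorem weightedSumLaw_single {ν : Measure ℝ} [IsProbabilityMeasure ν] {n : ℕ} (j : Fin n) :
    weightedSumLaw ν n (Pi.single j 1) = ν := by
  have : (fun x : Fin n → ℝ => ∑ i, (Pi.single j 1 : Fin n → ℝ) i * x i) = Function.eval j := by
    ext x
    simp [Pi.single_apply]
  rw [weightedSumLaw, this]
  exact (measurePreserving_eval (fun _ : Fin n => ν) j).map_eq

section
variable {p : ℝ} (hp : 1 ≤ p)
variable {f : ℝ → ℝ} (hf : IsSqLogConcaveDensity f) {ν : Measure ℝ}
  (hν : ν = volume.withDensity fun x => ENNReal.ofReal (f x)) (hνl : IsUnimodalLaw p ν)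
  (hν2 : IsUnimodalLaw 2 ν)

include hν hν2 in
-- A law with a density has no atom at the origin, so the comparison Gaussian is nondegenerate.
theorem integral_sq_pos : Integrable (fun x : ℝ => x ^ 2) ν ∧ 0 < ∫ x, x ^ 2 ∂ν := by
  have := hν2.prob
  have hi : Integrable (fun x : ℝ => x ^ 2) ν := by
    have := hν2.memLp.integrable_abs_rpow two_pos
    simpa using this
  refine ⟨hi, lt_of_le_of_ne (integral_nonneg fun x => sq_nonneg x) fun h => ?_⟩
  have h0 := (integral_eq_zero_iff_of_nonneg (fun x => sq_nonneg x) hi).1 h.symm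
  have h1 : ∀ᵐ x ∂ν, x ≠ 0 := by
    have hac : ν ≪ volume := hν ▸ withDensity_absolutelyContinuous _ _
    exact hac.ae_le (Measure.ae_ne volume 0)
  have h2 : ∀ᵐ x ∂ν, False := by
    filter_upwards [h0, h1] with x hx hx'
    exact hx' (by simpa using hx)
  simp [Filter.eventually_false_iff_eq_bot, IsProbabilityMeasure.ne_zero] at h2

include hp hf hν hνl hν2

theorem weightedSum_moment_bounds {ε : ℝ} (hε : (2 ≤ p ∧ ε = 1) ∨ (p ≤ 2 ∧ ε = -1)) {n : ℕ}
    (a : Fin n → ℝ) :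
    ε * (√(∑ i, a i ^ 2) ^ p * ∫ s, |s| ^ p ∂ν) ≤ ε * ∫ s, |s| ^ p ∂(weightedSumLaw ν n a) ∧
      ε * ∫ s, |s| ^ p ∂(weightedSumLaw ν n a) ≤
        ε * (√(∫ x, x ^ 2 ∂ν) * √(∑ i, a i ^ 2) * gaussMoment p) ^ p := by
  have := hνl.prob
  obtain ⟨hi, hpos⟩ := integral_sq_pos hν hν2
  have hd := isUnimodalLaw_dirac p
  constructor
  · have h := moment_single_le_weightedSum hp hε hf hν hνl n a hd
    rw [Measure.conv_dirac_zero, Measure.conv_dirac_zero] at h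
    refine le_of_eq_of_le ?_ h
    have hm : Measurable fun x : ℝ => |x| ^ p := by fun_prop
    rw [integral_map (by fun_prop) hm.aestronglyMeasurable, ← integral_const_mul]
    congr 1
    refine integral_congr_ae (ae_of_all _ fun x => ?_)
    simp only
    rw [abs_mul, abs_of_nonneg (Real.sqrt_nonneg _),
      Real.mul_rpow (Real.sqrt_nonneg _) (abs_nonneg _)]
  · obtain ⟨v, hv⟩ : ∃ v : NNReal, ∫ x, x ^ 2 ∂ν = v := ⟨⟨_, hpos.le⟩, rfl⟩
    have hv0 : v ≠ 0 := by
      rintro rfl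
      exact hpos.ne' hv
    have h := moment_weightedSum_le_gaussianReal hp hε hf hν hνl hv0 hi hv n a hd
    rw [Measure.conv_dirac_zero, Measure.conv_dirac_zero, integral_abs_rpow_gaussianReal hp] at h
    refine h.trans_eq ?_
    rw [← Real.sqrt_mul hpos.le, hv, mul_comm (v : ℝ)]
    simp

theorem weightedSum_norm_bounds {n : ℕ} (a : Fin n → ℝ) :
    (2 ≤ p → √(∑ i, a i ^ 2) * (∫ s, |s| ^ p ∂ν) ^ (1 / p) ≤
        (∫ s, |s| ^ p ∂(weightedSumLaw ν n a)) ^ (1 / p) ∧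
      (∫ s, |s| ^ p ∂(weightedSumLaw ν n a)) ^ (1 / p) ≤
        √(∫ x, x ^ 2 ∂ν) * √(∑ i, a i ^ 2) * gaussMoment p) ∧
    (p ≤ 2 → (∫ s, |s| ^ p ∂(weightedSumLaw ν n a)) ^ (1 / p) ≤
        √(∑ i, a i ^ 2) * (∫ s, |s| ^ p ∂ν) ^ (1 / p) ∧
      √(∫ x, x ^ 2 ∂ν) * √(∑ i, a i ^ 2) * gaussMoment p ≤
        (∫ s, |s| ^ p ∂(weightedSumLaw ν n a)) ^ (1 / p)) := by
  have hp0 : 0 < p := by linarith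
  have hM : 0 ≤ ∫ s, |s| ^ p ∂(weightedSumLaw ν n a) := integral_nonneg fun s => by positivity
  have hm : 0 ≤ ∫ s, |s| ^ p ∂ν := integral_nonneg fun s => by positivity
  have hγ := gaussMoment_nonneg hp
  have e1 : √(∑ i, a i ^ 2) * (∫ s, |s| ^ p ∂ν) ^ (1 / p) =
      (√(∑ i, a i ^ 2) ^ p * ∫ s, |s| ^ p ∂ν) ^ (1 / p) := by
    rw [Real.mul_rpow (by positivity) hm, ← Real.rpow_mul (Real.sqrt_nonneg _),
      mul_one_div_cancel hp0.ne', Real.rpow_one]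
  have e2 : √(∫ x, x ^ 2 ∂ν) * √(∑ i, a i ^ 2) * gaussMoment p =
      ((√(∫ x, x ^ 2 ∂ν) * √(∑ i, a i ^ 2) * gaussMoment p) ^ p) ^ (1 / p) := by
    rw [← Real.rpow_mul (by positivity), mul_one_div_cancel hp0.ne', Real.rpow_one]
  have hip : 0 ≤ 1 / p := by positivity
  constructor
  · intro h
    obtain ⟨h1, h2⟩ := weightedSum_moment_bounds hp hf hν hνl hν2 (Or.inl ⟨h, rfl⟩) a
    rw [e1, e2]
    exact ⟨Real.rpow_le_rpow (by positivity) (by linarith) hip,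
      Real.rpow_le_rpow hM (by linarith) hip⟩
  · intro h
    obtain ⟨h1, h2⟩ := weightedSum_moment_bounds hp hf hν hνl hν2 (Or.inr ⟨h, rfl⟩) a
    rw [e1, e2]
    exact ⟨Real.rpow_le_rpow hM (by linarith) hip,
      Real.rpow_le_rpow (by positivity) (by linarith) hip⟩

end

/-! ### The inequalities and the optimality of the constants. -/

/-- The Khintchine inequalities for a random vector whose weighted sums have moments proportional to
those of weighted sums of independent variables with a square-log-concave density. -/
theorem khintchine_of_momentNorm_eq {q : ℝ≥0∞} {n : ℕ} (hn : 1 ≤ n)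
    {Ω : Type*} [MeasurableSpace Ω] (P : Measure Ω) (X : Ω → Fin n → ℝ) {p : ℝ} (hp : 1 ≤ p)
    {f : ℝ → ℝ} (hf : IsSqLogConcaveDensity f) {ν : Measure ℝ}
    (hν : ν = volume.withDensity fun x => ENNReal.ofReal (f x)) (hνl : IsUnimodalLaw p ν)
    (hν2 : IsUnimodalLaw 2 ν)
    (hmom : ∀ r, 1 ≤ r → 0 < betaConst r q n ∧ ∀ a : Fin n → ℝ,
      momentNorm P (fun ω => ∑ i, a i * X ω i) r =
        betaConst r q n * (∫ s, |s| ^ r ∂(weightedSumLaw ν n a)) ^ (1 / r)) :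
    (∀ a : Fin n → ℝ,
      khintchineA P (fun ω => X ω ⟨0, hn⟩) p q n * momentNorm P (fun ω => ∑ i, a i * X ω i) 2
          ≤ momentNorm P (fun ω => ∑ i, a i * X ω i) p ∧
      momentNorm P (fun ω => ∑ i, a i * X ω i) p
          ≤ khintchineB P (fun ω => X ω ⟨0, hn⟩) p q n *
              momentNorm P (fun ω => ∑ i, a i * X ω i) 2) ∧
    (2 ≤ p → IsGreatest
      {A : ℝ | ∀ a : Fin n → ℝ, A * momentNorm P (fun ω => ∑ i, a i * X ω i) 2
          ≤ momentNorm P (fun ω => ∑ i, a i * X ω i) p}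
      (khintchineA P (fun ω => X ω ⟨0, hn⟩) p q n)) ∧
    (p < 2 → IsLeast
      {B : ℝ | ∀ a : Fin n → ℝ, momentNorm P (fun ω => ∑ i, a i * X ω i) p
          ≤ B * momentNorm P (fun ω => ∑ i, a i * X ω i) 2}
      (khintchineB P (fun ω => X ω ⟨0, hn⟩) p q n)) := by
  have := hνl.prob
  obtain ⟨hβ, hmp⟩ := hmom p hp
  obtain ⟨hβ2, hm2⟩ := hmom 2 one_le_two
  obtain ⟨-, hpos⟩ := integral_sq_pos hν hν2
  set σ := √(∫ x, x ^ 2 ∂ν) with hσ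
  have hσ0 : 0 < σ := Real.sqrt_pos.2 hpos
  set m := (∫ s, |s| ^ p ∂ν) ^ (1 / p) with hm
  have hσ2 : (∫ s, |s| ^ (2 : ℝ) ∂ν) ^ (1 / 2 : ℝ) = σ := by
    rw [hσ, Real.sqrt_eq_rpow]
    simp
  have hfirst : (fun ω => X ω ⟨0, hn⟩) =
      fun ω => ∑ i, (Pi.single ⟨0, hn⟩ 1 : Fin n → ℝ) i * X ω i := by
    ext ω
    simp [Pi.single_apply]
  have hX2 : momentNorm P (fun ω => X ω ⟨0, hn⟩) 2 = betaConst 2 q n * σ := by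
    rw [hfirst, hm2, weightedSumLaw_single, hσ2]
  have hXp : momentNorm P (fun ω => X ω ⟨0, hn⟩) p = betaConst p q n * m := by
    rw [hfirst, hmp, weightedSumLaw_single]
  have hS2 : ∀ a : Fin n → ℝ, momentNorm P (fun ω => ∑ i, a i * X ω i) 2 =
      betaConst 2 q n * (√(∑ i, a i ^ 2) * σ) := by
    intro a
    obtain ⟨h1, h2⟩ := weightedSum_norm_bounds one_le_two hf hν hν2 hν2 a
    rw [hσ2] at h1 h2
    -- The exponent `2` belongs to both regimes, and the two opposite bounds give the second moment
    -- exactly.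
    rw [hm2, le_antisymm (h2 le_rfl).1 (h1 le_rfl).1]
  have hpos2 : 0 < betaConst 2 q n * σ := mul_pos hβ2 hσ0
  have hratio : ∀ s : ℝ, betaConst p q n * m / (betaConst 2 q n * σ) *
      (betaConst 2 q n * (s * σ)) = betaConst p q n * (s * m) := by
    intro s
    field_simp
  have hgauss : ∀ s : ℝ, betaConst p q n / betaConst 2 q n * gaussMoment p *
      (betaConst 2 q n * (s * σ)) = betaConst p q n * (σ * s * gaussMoment p) := by
    intro s
    field_simp
  have main : ∀ a : Fin n → ℝ,
      khintchineA P (fun ω => X ω ⟨0, hn⟩) p q n * momentNorm P (fun ω => ∑ i, a i * X ω i) 2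
          ≤ momentNorm P (fun ω => ∑ i, a i * X ω i) p ∧
      momentNorm P (fun ω => ∑ i, a i * X ω i) p
          ≤ khintchineB P (fun ω => X ω ⟨0, hn⟩) p q n *
              momentNorm P (fun ω => ∑ i, a i * X ω i) 2 := by
    intro a
    obtain ⟨hge, hle⟩ := weightedSum_norm_bounds hp hf hν hνl hν2 a
    rw [hS2, hmp, khintchineA, khintchineB, hX2, hXp]
    by_cases h : p < 2
    · rw [if_pos h, if_pos h, hratio, hgauss]
      obtain ⟨h1, h2⟩ := hle h.le
      exact ⟨mul_le_mul_of_nonneg_left h2 hβ.le, mul_le_mul_of_nonneg_left h1 hβ.le⟩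
    · rw [if_neg h, if_neg h, hratio, hgauss]
      obtain ⟨h1, h2⟩ := hge (not_lt.1 h)
      exact ⟨mul_le_mul_of_nonneg_left h1 hβ.le, mul_le_mul_of_nonneg_left h2 hβ.le⟩
  refine ⟨main, fun h => ⟨fun a => (main a).1, fun A hA => ?_⟩,
    fun h => ⟨fun a => (main a).2, fun B hB => ?_⟩⟩
  -- For the first basis vector the weighted sum is `X₁` itself, which attains the ratio of norms.
  · have h1 := hA (Pi.single ⟨0, hn⟩ 1)
    rw [← hfirst, hX2] at h1
    rw [khintchineA, if_neg (not_lt.2 h), hX2, le_div_iff₀ hpos2]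
    exact h1
  · have h1 := hB (Pi.single ⟨0, hn⟩ 1)
    rw [← hfirst, hX2] at h1
    rw [khintchineB, if_pos h, hX2, div_le_iff₀ hpos2]
    exact h1

open ProbabilityTheory in
theorem integral_cond_ball {q : ℝ} (hq : 2 ≤ q) {n : ℕ} {r : ℝ} (hr : 1 ≤ r) (a : Fin n → ℝ) :
    ∫ x, |∑ i, a i * x i| ^ r ∂(cond volume {x : Fin n → ℝ | ∑ i, |x i| ^ q ≤ 1}) =
      Real.Gamma (n / q + 1) / Real.Gamma ((n + r) / q + 1) *
        ∫ s, |s| ^ r ∂(weightedSumLaw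
          (volume.withDensity fun x => ENNReal.ofReal (expPowerDensity q x)) n a) := by
  have hq0 : 0 < q := by linarith
  have h := lintegral_cond_ball hq (n := n) (r := r) (by linarith)
    (Φ := fun x => ENNReal.ofReal (|∑ i, a i * x i| ^ r)) (by fun_prop) ?_
  · have hm : Measurable fun x : Fin n → ℝ => |∑ i, a i * x i| ^ r := by fun_prop
    have hnn : ∀ x : Fin n → ℝ, 0 ≤ |∑ i, a i * x i| ^ r := fun x => by positivity
    have hΓ0 : 0 < Real.Gamma (n / q + 1) := Real.Gamma_pos_of_pos (by positivity)
    have hΓr : 0 < Real.Gamma ((n + r) / q + 1) := Real.Gamma_pos_of_pos (by positivity)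
    have h' := congrArg ENNReal.toReal h
    rw [ENNReal.toReal_mul, ENNReal.toReal_mul, ENNReal.toReal_ofReal hΓ0.le,
      ENNReal.toReal_ofReal hΓr.le,
      ← integral_eq_lintegral_of_nonneg_ae (ae_of_all _ hnn) hm.aestronglyMeasurable,
      ← integral_eq_lintegral_of_nonneg_ae (ae_of_all _ hnn) hm.aestronglyMeasurable] at h'
    rw [integral_weightedSumLaw]
    rw [div_mul_eq_mul_div, eq_div_iff hΓr.ne', mul_comm, h']
  · intro t ht x
    rw [← ENNReal.ofReal_mul (by positivity)]
    congr 1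
    simp only [Pi.smul_apply, smul_eq_mul]
    rw [← Real.mul_rpow ht.le (abs_nonneg _), ← abs_of_pos ht, ← abs_mul, abs_of_pos ht,
      Finset.mul_sum]
    congr 2
    exact Finset.sum_congr rfl fun i _ => by ring

theorem mainTheorem6 (q : ℝ≥0∞) (hq : 2 ≤ q) (n : ℕ) (hn : 1 ≤ n)
    {Ω : Type*} [MeasurableSpace Ω] (P : Measure Ω) [IsProbabilityMeasure P]
    (X : Ω → Fin n → ℝ) (hX : pdf.IsUniform X (lqBall q n) P volume)
    (p : ℝ) (hp : 1 ≤ p) :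
    (∀ a : Fin n → ℝ,
      khintchineA P (fun ω => X ω ⟨0, hn⟩) p q n * momentNorm P (fun ω => ∑ i, a i * X ω i) 2
          ≤ momentNorm P (fun ω => ∑ i, a i * X ω i) p ∧
      momentNorm P (fun ω => ∑ i, a i * X ω i) p
          ≤ khintchineB P (fun ω => X ω ⟨0, hn⟩) p q n *
              momentNorm P (fun ω => ∑ i, a i * X ω i) 2) ∧
    (2 ≤ p → IsGreatest
      {A : ℝ | ∀ a : Fin n → ℝ, A * momentNorm P (fun ω => ∑ i, a i * X ω i) 2
          ≤ momentNorm P (fun ω => ∑ i, a i * X ω i) p}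
      (khintchineA P (fun ω => X ω ⟨0, hn⟩) p q n)) ∧
    (p < 2 → IsLeast
      {B : ℝ | ∀ a : Fin n → ℝ, momentNorm P (fun ω => ∑ i, a i * X ω i) p
          ≤ B * momentNorm P (fun ω => ∑ i, a i * X ω i) 2}
      (khintchineB P (fun ω => X ω ⟨0, hn⟩) p q n)) := by
  have hp0 : 0 < p := by linarith
  have htransfer : ProbabilityTheory.cond volume (lqBall q n) Set.univ ≠ 0 →
      ∀ (a : Fin n → ℝ) (r : ℝ), momentNorm P (fun ω => ∑ i, a i * X ω i) r =
        (∫ x, |∑ i, a i * x i| ^ r ∂(ProbabilityTheory.cond volume (lqBall q n))) ^ (1 / r) := by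
    intro hne a r
    -- Uniformity only fixes the pushforward of `P`, and the pushforward along a map that is not
    -- a.e. measurable is zero by convention. A nonzero uniform law excludes this.
    have hXm : AEMeasurable X P := by
      by_contra hcon
      have hX' : Measure.map X P = ProbabilityTheory.cond volume (lqBall q n) := hX
      rw [Measure.map_of_not_aemeasurable hcon] at hX'
      exact hne (by rw [← hX']; simp)
    have hm : Measurable fun x : Fin n → ℝ => |∑ i, a i * x i| ^ r := by fun_prop
    rw [momentNorm, ← hX, integral_map hXm hm.aestronglyMeasurable]
  rcases eq_or_ne q ∞ with rfl | hqt
  · have hball : lqBall ∞ n = {x : Fin n → ℝ | ∀ i, |x i| ≤ 1} := by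
      ext x
      simp [lqBall]
    have hprob := (isUnimodalLaw_uniform 1).prob
    rw [hball, cond_cube_eq_pi] at htransfer
    refine khintchine_of_momentNorm_eq hn P X hp isSqLogConcaveDensity_uniform rfl
      (isUnimodalLaw_uniform p) (isUnimodalLaw_uniform 2) fun r hr => ?_
    have hβ : betaConst r ∞ n = 1 := by simp [betaConst]
    rw [hβ]
    refine ⟨one_pos, fun a => ?_⟩
    rw [htransfer (by simp), integral_weightedSumLaw, one_mul]
  · have hq2 : 2 ≤ q.toReal := by
      have := ENNReal.toReal_mono hqt hq
      simpa using this
    have hq0 : 0 < q.toReal := by linarith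
    have hball : lqBall q n = {x : Fin n → ℝ | ∑ i, |x i| ^ q.toReal ≤ 1} := by
      ext x
      simp [lqBall, hqt]
    have hprob := isProbabilityMeasure_expPower hq2
    rw [hball] at htransfer
    -- The case `Φ = 1`, `r = 0` of the moment identity would otherwise give `Γ(n/q + 1) = 0`.
    have hne : ProbabilityTheory.cond volume {x : Fin n → ℝ | ∑ i, |x i| ^ q.toReal ≤ 1}
        Set.univ ≠ 0 := by
      intro h0
      have h1 := lintegral_cond_ball hq2 (n := n) (le_refl 0) (Φ := fun _ => 1) measurable_const
        (by simp)
      simp only [lintegral_const, h0, mul_zero, measure_univ, mul_one] at h1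
      have : 0 < Real.Gamma (n / q.toReal + 1) := Real.Gamma_pos_of_pos (by positivity)
      exact (ENNReal.ofReal_pos.2 this).ne h1
    refine khintchine_of_momentNorm_eq hn P X hp (isSqLogConcaveDensity_expPower hq2) rfl
      (isUnimodalLaw_expPower hq2 hp0) (isUnimodalLaw_expPower hq2 two_pos) fun r hr => ?_
    have hΓ0 : 0 < Real.Gamma (n / q.toReal + 1) := Real.Gamma_pos_of_pos (by positivity)
    have hΓr : 0 < Real.Gamma ((n + r) / q.toReal + 1) := Real.Gamma_pos_of_pos (by positivity)
    have hΓ : 0 < Real.Gamma (n / q.toReal + 1) / Real.Gamma ((n + r) / q.toReal + 1) :=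
      div_pos hΓ0 hΓr
    rw [betaConst, if_neg hqt]
    refine ⟨Real.rpow_pos_of_pos hΓ _, fun a => ?_⟩
    rw [htransfer hne, integral_cond_ball hq2 hr,
      Real.mul_rpow hΓ.le (integral_nonneg fun s => by positivity)]
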